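/- Identify $\mathbb R^2$ with $\mathbb C$ (Lebesgue measure) and let $$\mathcal T(f_1,f_2,f_3)(z)=\int_{\mathbb R}\int_{\mathbb C} f_1(x+z)\,f_2(i\lambda x+z)\,\overline{f_3(x+i\lambda x+z)}\,dx\,d\lambda ,\qquad \mathcal E(f)=\int_{\mathbb C}\mathcal T(f,f,f)\,\overline f .$$ Consider the equation $i\partial_t u=\mathcal T(u,u,u)$ in the Bargmann–Fock space $\mathcal B$ of all $u\in L^2(\mathbb C)$ of the form $u(z)=f(z)e^{-|z|^2/2}$ with $f$ entire. For $N\ge 0$ let $\phi_N(z)=\frac{1}{\sqrt{\pi N!}}z^Ne^{-|z|^2/2}$ and $\omega_N=\mathcal E(\phi_N)$. The wave $u_N(t)=e^{-i\omega_N t}\phi_N$ is a solution of this equation in $\mathcal B$. The linearized equation around it is $$i\partial_t v=\mathcal T(v,u_N,u_N)+\mathcal T(u_N,v,u_N)+\mathcal T(u_N,u_N,v),$$ for $v:\mathbb R\to\mathcal B$ differentiable in $L^2$. A growing mode is a nonzero solution $v$ of the linearized equation of the form $v(t)=e^{-i\omega_Nt}\left(e^{\mu t}a+e^{\overline{\mu}t}b\right)$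 with $a,b\in\mathcal B$, $\mu\in\mathbb C$, $\operatorname{Re}\mu>0$. The wave $u_N$ is called linearly stable if there is no growing mode and linearly unstable otherwise; the number of unstable modes is the dimension over $\mathbb R$ of the real vector space of solutions spanned by the growing modes. Then: (i) If $N=0$ or $N=1$, $u_N$ is linearly stable; moreover every solution $v$ of the linearized equation in $\mathcal B$ satisfies $\|v(t)\|_{L^2}=O(e^{\sigma t})$ as $t\to+\infty$ for every $\sigma>0$. (ii) If $N\ge 2$, $u_N$ is linearly unstable. (iii) For every $N$ the number of unstable modes of $u_N$ is finite, and it is $o(N)$ as $N\to\infty$. -/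

import Mathlib

open MeasureTheory Filter Topology Asymptotics

noncomputable section

namespace CR

/-- The trilinear operator `T(f₁, f₂, f₃)` of the continuous resonant equation. The plane `ℝ²` is
identified with `ℂ` (with Lebesgue measure), so that the rotation `x ↦ x^⊥` by `π/2` is
`x ↦ I * x`. -/
def T (f₁ f₂ f₃ : ℂ → ℂ) (z : ℂ) : ℂ :=
  ∫ l : ℝ, ∫ x : ℂ,
    f₁ (x + z) * f₂ ((l : ℂ) * (Complex.I * x) + z) *
      (starRingEnd ℂ) (f₃ (x + (l : ℂ) * (Complex.I * x) + z))

/-- The quadrilinear form `E(f₁, f₂, f₃, f₄) = ⟨T(f₁, f₂, f₃), f₄⟩` in `L²`. -/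
def E (f₁ f₂ f₃ f₄ : ℂ → ℂ) : ℂ :=
  ∫ z : ℂ, T f₁ f₂ f₃ z * (starRingEnd ℂ) (f₄ z)

/-- The Hamiltonian `E(f) = E(f, f, f, f)`, which is a real quantity. -/
def energy (f : ℂ → ℂ) : ℝ := (E f f f f).re

/-- The Bargmann–Fock space: square integrable functions of the form
(entire function) `* exp (-|z|² / 2)`. -/
def BargmannFock : Set (ℂ → ℂ) :=
  {u | MemLp u 2 volume ∧
    ∃ f : ℂ → ℂ, Differentiable ℂ f ∧
      ∀ z, u z = f z * ((Real.exp (-‖z‖ ^ 2 / 2) : ℝ) : ℂ)}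

/-- The special Hermite function `φ_n(z) = (π n!)^{-1/2} z^n exp (-|z|² / 2)`. -/
def phi (n : ℕ) (z : ℂ) : ℂ :=
  ((1 / Real.sqrt (Real.pi * (n.factorial : ℝ)) : ℝ) : ℂ) * z ^ n *
    ((Real.exp (-‖z‖ ^ 2 / 2) : ℝ) : ℂ)

/-- The frequency `ω_N = E(φ_N)`. -/
def omega (N : ℕ) : ℝ := energy (phi N)

/-- The wave `φ_N e^{-i ω_N t}`. -/
def wave (N : ℕ) (t : ℝ) (z : ℂ) : ℂ :=
  Complex.exp (-(Complex.I * (omega N : ℂ) * (t : ℂ))) * phi N z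

/-- The curve `v` of functions is differentiable at time `t`, with derivative `w`, in the sense
of `L²`. -/
def HasL2DerivAt (v : ℝ → ℂ → ℂ) (w : ℂ → ℂ) (t : ℝ) : Prop :=
  Tendsto
    (fun h : ℝ => eLpNorm (fun z : ℂ => (v (t + h) z - v t z) / (h : ℂ) - w z) 2 volume)
    (𝓝[≠] 0) (𝓝 0)

/-- `u` is a global solution of `i ∂ₜ u = T(u, u, u)` in the Bargmann–Fock space. -/
def IsSolution (u : ℝ → ℂ → ℂ) : Prop :=
  (∀ t, u t ∈ BargmannFock) ∧
    ∀ t, HasL2DerivAt u (fun z => -Complex.I * T (u t) (u t) (u t) z) t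

/-- `v` is a global solution, in the Bargmann–Fock space, of the linearization
`i ∂ₜ v = T(v, u, u) + T(u, v, u) + T(u, u, v)` of the equation around the wave
`u = φ_N e^{-i ω_N t}`. -/
def IsLinearizedSolution (N : ℕ) (v : ℝ → ℂ → ℂ) : Prop :=
  (∀ t, v t ∈ BargmannFock) ∧
    ∀ t, HasL2DerivAt v
      (fun z => -Complex.I *
        (T (v t) (wave N t) (wave N t) z + T (wave N t) (v t) (wave N t) z +
          T (wave N t) (wave N t) (v t) z)) t

/-- An exponentially growing (unstable) mode: a nonzero solution of the linearized equation which,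
in the frame rotating with the wave, is of the form `e^{μ t} a + e^{conj μ t} b` with `Re μ > 0`.
Both exponentials are present because the linearized equation is only real-linear. -/
def IsGrowingMode (N : ℕ) (v : ℝ → ℂ → ℂ) : Prop :=
  IsLinearizedSolution N v ∧ v ≠ 0 ∧
    ∃ μ : ℂ, 0 < μ.re ∧ ∃ a ∈ BargmannFock, ∃ b ∈ BargmannFock, ∀ (t : ℝ) (z : ℂ),
      v t z = Complex.exp (-(Complex.I * (omega N : ℂ) * (t : ℂ))) *
        (Complex.exp (μ * (t : ℂ)) * a z + Complex.exp ((starRingEnd ℂ) μ * (t : ℂ)) * b z)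

/-- Linear stability: absence of exponentially growing modes. -/
def LinearlyStable (N : ℕ) : Prop := ∀ v, ¬ IsGrowingMode N v

/-- Linear instability: existence of an exponentially growing mode. -/
def LinearlyUnstable (N : ℕ) : Prop := ∃ v, IsGrowingMode N v

/-- The real vector space of solutions spanned by the exponentially growing modes; its real
dimension is the number of unstable modes. -/
def unstableSpace (N : ℕ) : Submodule ℝ (ℝ → ℂ → ℂ) :=
  Submodule.span ℝ {v | IsGrowingMode N v}

end CR

end

namespace CR

/-! On functions F(z) e^{-|z|²/2} with F entire, the operator `T` collapses. The points z, x+z,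
iλx+z and ζ = x+iλx+z are the vertices of a rectangle, so the Gaussians combine to e^{-|z|²/2}
e^{-|ζ|²}. After the substitution ζ = z+(1+iλ)x, of Jacobian 1+λ², the λ-integral at fixed ζ is π
times the mean of an entire function over a circle. The mean value property puts both F₁ and F₂ at
the midpoint (z+ζ)/2; this is `T_gw`.

Gaussian integrals against powers of the conjugate of ζ read off Taylor coefficients
(`integral_mul_conj_pow_gaussian`), so the linearization at φ_N is explicit in the basis φ_n. The
two terms with v in a holomorphic slot are diagonal with eigenvalue πα(N,n); the conjugate-linear
term couples n only to 2N-n, with coefficient πβ(N,n). In the rotating frame (`hasDerivAt_rotCoef`),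
x_n' = -iπ((2α_n - α_N) x_n + β_n conj x_{2N-n}), and the modes n > 2N are decoupled, with |x_n|
constant.

For a pair (n, 2N-n) put S = α_n + α_{2N-n} - α_N. The pair has growing exponentials exactly when
`disc` = β² - S² > 0, and then the rate is π√disc. The mode n = N is degenerate and grows at most
linearly. For N = 1 the only other pair satisfies β < S, where a definite quadratic form is
conserved; for N = 0 there is no other pair. The pair (N+1, N-1) is never unstable, its discriminant
being -α_N²/(4(N+1)²), but (N+2, N-2) is unstable for every N ≥ 2 (`disc_pos`).

For the count, α_{N±k} and β_{N+k} are at most α_N times a Gaussian in k/√N. Once k is a large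
multiple of √N, S is close to -α_N and dominates β, so only O(√N) modes are unstable
(`disc_nonpos_of_large`, `card_unstableModes_le`). -/

/-! ### Mean values and Gaussian integrals of entire functions. -/

theorem integral_comp_complex_mul_left (g : ℂ → ℂ) {c : ℂ} (hc : c ≠ 0) :
    ∫ x : ℂ, g (c * x) = ((‖c‖ ^ 2)⁻¹ : ℝ) • ∫ x : ℂ, g x := by
  have h0 : (‖c‖ : ℂ) ≠ 0 := by simpa using hc
  let a : Circle := ⟨c / ‖c‖, by
    simp [Submonoid.unitSphere, hc]⟩
  have hrot : MeasurePreserving (rotation a) volume volume :=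
    (rotation a).measurePreserving
  have h1 := hrot.integral_comp (rotation a).toHomeomorph.measurableEmbedding
    (fun x => g ((‖c‖ : ℝ) • x))
  have h2 := Measure.integral_comp_smul (volume : Measure ℂ) g (‖c‖ : ℝ)
  rw [h2] at h1
  have h3 : ∀ x : ℂ, (‖c‖ : ℝ) • (rotation a x) = c * x := by
    intro x
    rw [rotation_apply, Complex.real_smul]
    change (‖c‖ : ℂ) * (c / ‖c‖ * x) = _
    field_simp
  simp only [h3, Complex.finrank_real_complex] at h1
  rw [h1, abs_of_nonneg (by positivity)]

/-- With l = tan x one has 1/(1+il) = cos x · e^{-ix} = 1/2 + e^{-2ix}/2, and dl/(1+l²) = dx. The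
integral is therefore π times the average of G over the circle of centre 1/2 and radius 1/2. -/
theorem integral_inv_one_add_sq_smul_comp {G : ℂ → ℂ} (hG : Differentiable ℂ G) :
    ∫ l : ℝ, ((1 + l ^ 2)⁻¹ : ℝ) • G (1 / (1 + l * Complex.I)) = Real.pi * G (1 / 2) := by
  have himg : Real.tan '' Set.Ioo (-(Real.pi / 2)) (Real.pi / 2) = Set.univ :=
    Set.eq_univ_of_forall fun y => Real.surjOn_tan (Set.mem_univ y)
  rw [← setIntegral_univ, ← himg, integral_image_eq_integral_abs_deriv_smul (f' := fun x => 1 / Real.cos x ^ 2)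
    measurableSet_Ioo (fun x hx => (Real.hasDerivAt_tan_of_mem_Ioo hx).hasDerivWithinAt)
    Real.injOn_tan]
  have h1 : ∀ x ∈ Set.Ioo (-(Real.pi / 2)) (Real.pi / 2),
      |1 / Real.cos x ^ 2| • ((1 + Real.tan x ^ 2)⁻¹ : ℝ) • G (1 / (1 + Real.tan x * Complex.I))
        = G (circleMap (1 / 2) (1 / 2) (-2 * x)) := by
    intro x hx
    have hc : Real.cos x ≠ 0 := (Real.cos_pos_of_mem_Ioo hx).ne'
    have hc' : Complex.cos x ≠ 0 := by exact_mod_cast hc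
    rw [← Real.inv_one_add_tan_sq hc, smul_smul, abs_of_nonneg (by positivity)]
    have : 1 / (1 + Real.tan x ^ 2)⁻¹ * (1 + Real.tan x ^ 2)⁻¹ = 1 := by
      have : (1 + Real.tan x ^ 2) ≠ 0 := by positivity
      field_simp
    rw [this, one_smul]
    congr 1
    rw [circleMap, Complex.ofReal_tan, Complex.tan_eq_sin_div_cos]
    have he : Complex.exp (((-2 * x : ℝ) : ℂ) * Complex.I)
        = (Complex.cos x - Complex.sin x * Complex.I) ^ 2 := by
      rw [Complex.cos_sub_sin_I]
      rw [← Complex.exp_nat_mul]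
      congr 1
      push_cast
      ring
    rw [he]
    have h2 := Complex.sin_sq_add_cos_sq (x : ℂ)
    have h3 : Complex.cos x + Complex.sin x * Complex.I ≠ 0 := by
      rw [← Complex.exp_mul_I]; exact Complex.exp_ne_zero _
    have h4 : 1 / (1 + Complex.sin x / Complex.cos x * Complex.I)
        = Complex.cos x / (Complex.cos x + Complex.sin x * Complex.I) := by
      field_simp
    rw [h4, div_eq_iff h3]
    push_cast
    linear_combination (-(Complex.cos x) / 2 + Complex.I * Complex.sin x / 2) * h2
      + (Complex.cos x * Complex.sin x ^ 2 / 2 - Complex.sin x ^ 3 * Complex.I / 2) * Complex.I_sq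
  rw [setIntegral_congr_fun measurableSet_Ioo h1, ← integral_Ioc_eq_integral_Ioo,
    ← intervalIntegral.integral_of_le (by linarith [Real.pi_pos])]
  rw [intervalIntegral.integral_comp_mul_left (fun θ => G (circleMap (1 / 2) (1 / 2) θ)) (by norm_num)]
  have hper : Function.Periodic (fun θ => G (circleMap (1 / 2) (1 / 2) θ)) (2 * Real.pi) :=
    fun θ => by simp only [periodic_circleMap (1 / 2) (1 / 2) θ]
  have h5 := hper.intervalIntegral_add_eq (-Real.pi) 0
  have h6 := circleAverage_of_differentiable_on_off_countable (f := G) (c := 1 / 2) (R := 1 / 2)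
    Set.countable_empty hG.continuous.continuousOn (fun z _ => hG z)
  rw [Real.circleAverage] at h6
  rw [intervalIntegral.integral_symm]
  have e1 : -2 * (Real.pi / 2) = -Real.pi := by ring
  have e2 : -2 * -(Real.pi / 2) = -Real.pi + 2 * Real.pi := by ring
  rw [e1, e2, h5, zero_add, ← h6]
  simp only [Complex.real_smul]
  push_cast
  have : (Real.pi : ℂ) ≠ 0 := by exact_mod_cast Real.pi_ne_zero
  field_simp

theorem integrable_exp_neg_mul_norm_sq {b : ℝ} (hb : 0 < b) :
    Integrable (fun z : ℂ => Real.exp (-b * ‖z‖ ^ 2)) := by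
  -- A non-integrable function has integral 0 by convention, which contradicts the positive closed
  -- formula.
  by_contra h
  have h1 := Complex.integral_exp_neg_mul_rpow (p := 2) (b := b) (by norm_num) hb
  simp only [Real.rpow_two] at h1
  rw [integral_undef h] at h1
  have : 0 < Real.pi * b ^ (-2 / 2 : ℝ) * Real.Gamma (2 / 2 + 1) :=
    mul_pos (mul_pos Real.pi_pos (Real.rpow_pos_of_pos hb _)) (Real.Gamma_pos_of_pos (by norm_num))
  linarith

theorem integral_norm_pow_mul_exp_neg (n : ℕ) :
    ∫ z : ℂ, ‖z‖ ^ (2 * n) * Real.exp (-‖z‖ ^ 2) = Real.pi * n.factorial := by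
  have h1 := Complex.integral_rpow_mul_exp_neg_rpow (p := 2) (q := 2 * n) (by norm_num)
    (by have : (0 : ℝ) ≤ n := n.cast_nonneg
        linarith)
  simp only [Real.rpow_two] at h1
  have e : ((2 * n + 2 : ℝ) / 2) = n + 1 := by ring
  rw [e, Real.Gamma_nat_eq_factorial] at h1
  have e2 : (2 * n : ℝ) = ((2 * n : ℕ) : ℝ) := by push_cast; ring
  rw [e2] at h1
  simp only [Real.rpow_natCast] at h1
  rw [h1]; ring

/-- The `n`-th Taylor coefficient at `0`. -/
noncomputable def tay (n : ℕ) (f : ℂ → ℂ) : ℂ := iteratedDeriv n f 0 / n.factorial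

theorem intervalIntegral_rotation {f : ℂ → ℂ} (hf : Differentiable ℂ f) (n : ℕ) (z : ℂ) :
    ∫ θ in (0 : ℝ)..2 * Real.pi, f (Complex.exp (θ * Complex.I) * z) *
      (starRingEnd ℂ) (Complex.exp (θ * Complex.I) * z) ^ n
      = 2 * Real.pi * (tay n f * z ^ n * (starRingEnd ℂ) z ^ n) := by
  -- Cauchy's formula is applied on the unit circle to w ↦ f(zw) instead of on the circle of radius
  -- |z|, so that z = 0 is not a special case.
  have hd : Differentiable ℂ (fun w => f (z * w)) := by fun_prop
  have h1 := (hd.differentiableOn (s := Metric.closedBall 0 1)).circleIntegral_one_div_sub_center_pow_smul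
    (R := 1) (c := 0) one_pos n
  rw [iteratedDeriv_comp_const_mul hf.contDiff] at h1
  simp only [circleIntegral, deriv_circleMap, mul_zero, smul_eq_mul, sub_zero] at h1
  have h2 : ∀ θ : ℝ, f (Complex.exp (θ * Complex.I) * z) *
      (starRingEnd ℂ) (Complex.exp (θ * Complex.I) * z) ^ n = (-Complex.I * (starRingEnd ℂ) z ^ n) *
      (circleMap 0 1 θ * Complex.I * (1 / circleMap 0 1 θ ^ (n + 1) * f (z * circleMap 0 1 θ))) := by
    intro θ
    have hc : circleMap 0 1 θ = Complex.exp (θ * Complex.I) := by simp [circleMap]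
    rw [hc]
    have hn : (starRingEnd ℂ) (Complex.exp (θ * Complex.I)) = (Complex.exp (θ * Complex.I))⁻¹ := by
      rw [← Complex.exp_conj, ← Complex.exp_neg]; simp
    have hne := Complex.exp_ne_zero (θ * Complex.I)
    rw [map_mul, hn, mul_pow, inv_pow, mul_comm z]
    field_simp
    linear_combination (f (Complex.exp (θ * Complex.I) * z) * (starRingEnd ℂ) z ^ n *
      (Complex.exp (θ * Complex.I) * Complex.exp (θ * Complex.I) ^ n)) * Complex.I_sq
  simp_rw [h2]
  rw [intervalIntegral.integral_const_mul, h1, tay]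
  linear_combination (-(2 * Real.pi * (starRingEnd ℂ) z ^ n * z ^ n * iteratedDeriv n f 0 *
    (n.factorial : ℂ)⁻¹)) * Complex.I_sq

/-- Lebesgue measure and the Gaussian are rotation invariant, so the integrand may be averaged over
rotations first. By Cauchy's formula the average retains only the n-th Taylor term, and the radial
moment π n! remains. -/
theorem integral_mul_conj_pow_gaussian {f : ℂ → ℂ} (hf : Differentiable ℂ f) (n : ℕ)
    (hi : Integrable (fun z : ℂ => f z * (starRingEnd ℂ) z ^ n * ((Real.exp (-‖z‖ ^ 2) : ℝ) : ℂ))) :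
    ∫ z : ℂ, f z * (starRingEnd ℂ) z ^ n * ((Real.exp (-‖z‖ ^ 2) : ℝ) : ℂ)
      = Real.pi * n.factorial * tay n f := by
  set F : ℂ → ℂ := fun z => f z * (starRingEnd ℂ) z ^ n * ((Real.exp (-‖z‖ ^ 2) : ℝ) : ℂ) with hF
  have hFc : Continuous F := by
    have := hf.continuous
    fun_prop
  have heq : ∀ θ : ℝ, (fun z => Complex.exp (θ * Complex.I) * z) = rotation (Circle.exp θ) := by
    intro θ
    ext z; simp [rotation_apply, Circle.coe_exp]
  have hmp : ∀ θ : ℝ, MeasurePreserving (fun z => Complex.exp (θ * Complex.I) * z) volume volume := by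
    intro θ
    rw [heq]
    exact (rotation (Circle.exp θ)).measurePreserving
  have hme : ∀ θ : ℝ, MeasurableEmbedding (fun z => Complex.exp (θ * Complex.I) * z) := by
    intro θ
    rw [heq]
    exact (rotation (Circle.exp θ)).toHomeomorph.measurableEmbedding
  have hrot : ∀ θ : ℝ, ∫ z, F (Complex.exp (θ * Complex.I) * z) = ∫ z, F z := fun θ =>
    (hmp θ).integral_comp (hme θ) F
  have hprod : Integrable (Function.uncurry fun (θ : ℝ) (z : ℂ) => F (Complex.exp (θ * Complex.I) * z))
      ((volume.restrict (Set.uIoc 0 (2 * Real.pi))).prod volume) := by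
    rw [integrable_prod_iff]
    · refine ⟨ae_of_all _ fun θ => ?_, ?_⟩
      · exact (hmp θ).integrable_comp_of_integrable hi
      · have : ∀ θ : ℝ, ∫ z, ‖F (Complex.exp (θ * Complex.I) * z)‖ = ∫ z, ‖F z‖ := fun θ =>
          (hmp θ).integral_comp (hme θ) (fun z => ‖F z‖)
        simp only [Function.uncurry, this]
        rw [Set.uIoc_of_le (by positivity)]
        exact integrable_const _
    · refine Continuous.aestronglyMeasurable ?_
      unfold Function.uncurry
      fun_prop
  have h1 : ∫ θ in (0 : ℝ)..2 * Real.pi, ∫ z, F (Complex.exp (θ * Complex.I) * z)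
      = 2 * Real.pi * ∫ z, F z := by
    simp_rw [hrot]
    rw [intervalIntegral.integral_const]
    simp
  rw [intervalIntegral_integral_swap hprod] at h1
  have h2 : ∀ z : ℂ, ∫ θ in (0 : ℝ)..2 * Real.pi, F (Complex.exp (θ * Complex.I) * z)
      = 2 * Real.pi * tay n f * ((‖z‖ ^ (2 * n) * Real.exp (-‖z‖ ^ 2) : ℝ) : ℂ) := by
    intro z
    have hn : ∀ θ : ℝ, F (Complex.exp (θ * Complex.I) * z) = ((Real.exp (-‖z‖ ^ 2) : ℝ) : ℂ) *
      (f (Complex.exp (θ * Complex.I) * z) * (starRingEnd ℂ) (Complex.exp (θ * Complex.I) * z) ^ n) := by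
      intro θ
      simp only [hF, norm_mul, Complex.norm_exp_ofReal_mul_I, one_mul]
      ring
    simp_rw [hn]
    rw [intervalIntegral.integral_const_mul, intervalIntegral_rotation hf]
    have : z ^ n * (starRingEnd ℂ) z ^ n = ((‖z‖ ^ (2 * n) : ℝ) : ℂ) := by
      rw [← mul_pow, Complex.mul_conj, Complex.normSq_eq_norm_sq, pow_mul]
      push_cast; rfl
    rw [Complex.ofReal_mul, ← this]
    ring
  simp_rw [h2] at h1
  rw [integral_const_mul, integral_complex_ofReal, integral_norm_pow_mul_exp_neg] at h1
  have hpi : (2 * Real.pi : ℂ) ≠ 0 := by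
    simp [Real.pi_ne_zero]
  apply mul_left_cancel₀ hpi
  rw [← h1]
  push_cast
  ring

/-! ### The trilinear operator on Gaussian-weighted entire functions. -/

/-- The function `f * exp (-|z|² / 2)`. -/
noncomputable def gw (f : ℂ → ℂ) (z : ℂ) : ℂ := f z * ((Real.exp (-‖z‖ ^ 2 / 2) : ℝ) : ℂ)

/-- Growth at most like `exp (κ |z|²)`. -/
def GaussBound (κ : ℝ) (f : ℂ → ℂ) : Prop :=
  ∃ C : ℝ, 0 ≤ C ∧ ∀ z, ‖f z‖ ≤ C * Real.exp (κ * ‖z‖ ^ 2)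

theorem norm_one_add_mul_I_sq (l : ℝ) : ‖(1 + l * Complex.I : ℂ)‖ ^ 2 = 1 + l ^ 2 := by
  rw [← Complex.normSq_eq_norm_sq, Complex.normSq_apply]; simp; ring

theorem one_add_mul_I_ne_zero (l : ℝ) : (1 + l * Complex.I : ℂ) ≠ 0 := by
  intro h
  have := norm_one_add_mul_I_sq l
  rw [h] at this
  simp at this
  nlinarith [sq_nonneg l]

/-- Opposite vertices of a rectangle have equal sums of squared distances to the origin. This is
what merges the Gaussian weights. -/
theorem norm_sq_add_norm_sq_add_norm_sq (l : ℝ) (x z : ℂ) :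
    ‖x + z‖ ^ 2 + ‖(l : ℂ) * (Complex.I * x) + z‖ ^ 2 + ‖x + (l : ℂ) * (Complex.I * x) + z‖ ^ 2
      = 2 * ‖z + (1 + l * Complex.I) * x‖ ^ 2 + ‖z‖ ^ 2 := by
  simp only [← Complex.normSq_eq_norm_sq, Complex.normSq_apply]
  simp
  ring

/-- Since z is fixed, only the coefficient of |ζ|² matters. It is kept at 5/4, near 1, so that the
critical growth κ = 1/2 of Bargmann–Fock functions stays integrable against e^{-|ζ|²}; the price is
the large factor 20 on |z|². -/
theorem gaussBound_comp_segment {κ : ℝ} (hκ : 0 ≤ κ) {F : ℂ → ℂ} {C : ℝ} (hC : 0 ≤ C)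
    (hF : ∀ z, ‖F z‖ ≤ C * Real.exp (κ * ‖z‖ ^ 2)) (z ζ s : ℂ) (hs : ‖s‖ ≤ 1) :
    ‖F (z + s * (ζ - z))‖ ≤
      C * Real.exp (20 * κ * ‖z‖ ^ 2) * Real.exp (5 / 4 * κ * ‖ζ‖ ^ 2) := by
  refine (hF _).trans ?_
  rw [mul_assoc, ← Real.exp_add]
  have h1 : ‖z + s * (ζ - z)‖ ≤ ‖ζ‖ + 2 * ‖z‖ := by
    calc ‖z + s * (ζ - z)‖ ≤ ‖z‖ + ‖s‖ * ‖ζ - z‖ := by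
          rw [← norm_mul]; exact norm_add_le _ _
      _ ≤ ‖z‖ + 1 * (‖ζ‖ + ‖z‖) := by gcongr; exact norm_sub_le _ _
      _ = _ := by ring
  have h2 : ‖z + s * (ζ - z)‖ ^ 2 ≤ 20 * ‖z‖ ^ 2 + 5 / 4 * ‖ζ‖ ^ 2 := by
    calc _ ≤ (‖ζ‖ + 2 * ‖z‖) ^ 2 := by gcongr
      _ ≤ _ := by nlinarith [sq_nonneg (‖ζ‖ / 2 - 4 * ‖z‖)]
  gcongr
  nlinarith [mul_le_mul_of_nonneg_left h2 hκ]

theorem T_gw {F₁ F₂ F₃ : ℂ → ℂ} {κ₁ κ₂ κ₃ : ℝ} (h₁ : Differentiable ℂ F₁) (h₂ : Differentiable ℂ F₂)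
    (h₃ : Continuous F₃) (b₁ : GaussBound κ₁ F₁) (b₂ : GaussBound κ₂ F₂) (b₃ : GaussBound κ₃ F₃)
    (k₁ : 0 ≤ κ₁) (k₂ : 0 ≤ κ₂) (hκ : 5 / 4 * (κ₁ + κ₂) + κ₃ < 1) (z : ℂ) :
    T (gw F₁) (gw F₂) (gw F₃) z = gw (fun z => Real.pi * ∫ ζ : ℂ, F₁ ((z + ζ) / 2) *
      F₂ ((z + ζ) / 2) * (starRingEnd ℂ) (F₃ ζ) * ((Real.exp (-‖ζ‖ ^ 2) : ℝ) : ℂ)) z := by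
  set g : ℂ := ((Real.exp (-‖z‖ ^ 2 / 2) : ℝ) : ℂ) with hg
  set K : ℝ → ℂ → ℂ := fun l ζ => ((1 + l ^ 2)⁻¹ : ℝ) •
    (F₁ (z + 1 / (1 + l * Complex.I) * (ζ - z)) * F₂ (z + (1 - 1 / (1 + l * Complex.I)) * (ζ - z)) *
      ((starRingEnd ℂ) (F₃ ζ) * ((Real.exp (-‖ζ‖ ^ 2) : ℝ) : ℂ))) with hK
  have hs1 : ∀ l : ℝ, ‖1 / (1 + l * Complex.I : ℂ)‖ ≤ 1 := by
    intro l
    rw [norm_div, norm_one]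
    apply div_le_one_of_le₀ _ (norm_nonneg _)
    rw [← abs_of_nonneg (norm_nonneg (1 + l * Complex.I : ℂ)), ← one_le_sq_iff_one_le_abs,
      norm_one_add_mul_I_sq]
    nlinarith [sq_nonneg l]
  have hs2 : ∀ l : ℝ, ‖1 - 1 / (1 + l * Complex.I : ℂ)‖ ≤ 1 := by
    intro l
    have hc := one_add_mul_I_ne_zero l
    have : 1 - 1 / (1 + l * Complex.I : ℂ) = l * Complex.I / (1 + l * Complex.I) := by
      field_simp; ring
    rw [this, norm_div]
    apply div_le_one_of_le₀ _ (norm_nonneg _)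
    apply le_of_sq_le_sq _ (norm_nonneg _)
    rw [norm_one_add_mul_I_sq]
    simp
  have hinner : ∀ l : ℝ, ∫ x : ℂ, gw F₁ (x + z) * gw F₂ ((l : ℂ) * (Complex.I * x) + z) *
      (starRingEnd ℂ) (gw F₃ (x + (l : ℂ) * (Complex.I * x) + z)) = g * ∫ ζ, K l ζ := by
    intro l
    have hc := one_add_mul_I_ne_zero l
    set W : ℂ → ℂ := fun w => g * (F₁ (z + 1 / (1 + l * Complex.I) * (z + w - z)) *
      F₂ (z + (1 - 1 / (1 + l * Complex.I)) * (z + w - z)) *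
      ((starRingEnd ℂ) (F₃ (z + w)) * ((Real.exp (-‖z + w‖ ^ 2) : ℝ) : ℂ))) with hW
    have e1 : ∀ x : ℂ, gw F₁ (x + z) * gw F₂ ((l : ℂ) * (Complex.I * x) + z) *
      (starRingEnd ℂ) (gw F₃ (x + (l : ℂ) * (Complex.I * x) + z)) =
      W ((1 + l * Complex.I) * x) := by
      intro x
      have a1 : z + 1 / (1 + l * Complex.I) * (z + (1 + l * Complex.I) * x - z) = x + z := by
        field_simp; ring
      have a2 : z + (1 - 1 / (1 + l * Complex.I)) * (z + (1 + l * Complex.I) * x - z)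
          = (l : ℂ) * (Complex.I * x) + z := by
        field_simp; ring
      have a3 : z + (1 + l * Complex.I) * x = x + (l : ℂ) * (Complex.I * x) + z := by ring
      have hn := norm_sq_add_norm_sq_add_norm_sq l x z
      simp only [hW, a1, a2]
      rw [a3] at hn ⊢
      have he : Real.exp (-‖x + z‖ ^ 2 / 2) * Real.exp (-‖(l : ℂ) * (Complex.I * x) + z‖ ^ 2 / 2) *
          Real.exp (-‖x + (l : ℂ) * (Complex.I * x) + z‖ ^ 2 / 2)
          = Real.exp (-‖z‖ ^ 2 / 2) * Real.exp (-‖x + (l : ℂ) * (Complex.I * x) + z‖ ^ 2) := by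
        rw [← Real.exp_add, ← Real.exp_add, ← Real.exp_add]
        congr 1
        linarith
      have he' := congrArg (fun r : ℝ => (r : ℂ)) he
      simp only [Complex.ofReal_mul] at he'
      simp only [gw, map_mul, Complex.conj_ofReal, hg]
      linear_combination (F₁ (x + z) * F₂ ((l : ℂ) * (Complex.I * x) + z) *
        (starRingEnd ℂ) (F₃ (x + (l : ℂ) * (Complex.I * x) + z))) * he'
    simp_rw [e1]
    rw [integral_comp_complex_mul_left W hc, norm_one_add_mul_I_sq, hW]
    rw [integral_const_mul, integral_add_left_eq_self (fun ζ => F₁ (z + 1 / (1 + l * Complex.I) * (ζ - z)) *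
        F₂ (z + (1 - 1 / (1 + l * Complex.I)) * (ζ - z)) *
        ((starRingEnd ℂ) (F₃ ζ) * ((Real.exp (-‖ζ‖ ^ 2) : ℝ) : ℂ)))]
    simp only [hK]
    rw [integral_smul, mul_smul_comm]
  obtain ⟨C₁, c₁, b₁⟩ := b₁
  obtain ⟨C₂, c₂, b₂⟩ := b₂
  obtain ⟨C₃, c₃, b₃⟩ := b₃
  -- Both points on the segment directions have parameter of modulus at most 1, so K is dominated by
  -- (1+l²)⁻¹ times a Gaussian in ζ whose rate is positive by `hκ`.
  have hint : Integrable (Function.uncurry K) (volume.prod volume) := by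
    have hdom := (integrable_inv_one_add_sq).mul_prod ((integrable_exp_neg_mul_norm_sq
      (b := 1 - (5 / 4 * (κ₁ + κ₂) + κ₃)) (by linarith)).const_mul
        ((C₁ * Real.exp (20 * κ₁ * ‖z‖ ^ 2)) * (C₂ * Real.exp (20 * κ₂ * ‖z‖ ^ 2)) * C₃))
    refine hdom.mono' ?_ (ae_of_all _ fun p => ?_)
    · refine Continuous.aestronglyMeasurable ?_
      have hc1 := h₁.continuous
      have hc2 := h₂.continuous
      have hi : Continuous fun p : ℝ × ℂ => 1 / (1 + (p.1 : ℂ) * Complex.I) :=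
        continuous_const.div (by fun_prop) fun p => one_add_mul_I_ne_zero p.1
      have hi' : Continuous fun p : ℝ × ℂ => ((1 + p.1 ^ 2)⁻¹ : ℝ) :=
        Continuous.inv₀ (by fun_prop) fun p => by positivity
      simp only [Function.uncurry_def, hK]
      fun_prop
    · obtain ⟨l, ζ⟩ := p
      simp only [Function.uncurry_apply_pair, hK, norm_smul, norm_mul, RCLike.norm_conj,
        Complex.norm_real, Real.norm_eq_abs, Real.abs_exp]
      rw [abs_of_nonneg (by positivity)]
      have d1 := gaussBound_comp_segment k₁ c₁ b₁ z ζ _ (hs1 l)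
      have d2 := gaussBound_comp_segment k₂ c₂ b₂ z ζ _ (hs2 l)
      have d3 := b₃ ζ
      refine mul_le_mul_of_nonneg_left ?_ (by positivity)
      calc _ ≤ (C₁ * Real.exp (20 * κ₁ * ‖z‖ ^ 2) * Real.exp (5 / 4 * κ₁ * ‖ζ‖ ^ 2)) *
            (C₂ * Real.exp (20 * κ₂ * ‖z‖ ^ 2) * Real.exp (5 / 4 * κ₂ * ‖ζ‖ ^ 2)) *
            (C₃ * Real.exp (κ₃ * ‖ζ‖ ^ 2) * Real.exp (-‖ζ‖ ^ 2)) := by gcongr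
        _ = _ := by
          have : Real.exp (-(1 - (5 / 4 * (κ₁ + κ₂) + κ₃)) * ‖ζ‖ ^ 2) =
            Real.exp (5 / 4 * κ₁ * ‖ζ‖ ^ 2) * Real.exp (5 / 4 * κ₂ * ‖ζ‖ ^ 2) *
            Real.exp (κ₃ * ‖ζ‖ ^ 2) * Real.exp (-‖ζ‖ ^ 2) := by
            rw [← Real.exp_add, ← Real.exp_add, ← Real.exp_add]
            congr 1; ring
          rw [this]; ring
  have hmean : ∀ ζ : ℂ, ∫ l : ℝ, K l ζ = Real.pi * (F₁ ((z + ζ) / 2) *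
      F₂ ((z + ζ) / 2) * (starRingEnd ℂ) (F₃ ζ) * ((Real.exp (-‖ζ‖ ^ 2) : ℝ) : ℂ)) := by
    intro ζ
    have hd : Differentiable ℂ fun s : ℂ => F₁ (z + s * (ζ - z)) * F₂ (z + (1 - s) * (ζ - z)) *
      ((starRingEnd ℂ) (F₃ ζ) * ((Real.exp (-‖ζ‖ ^ 2) : ℝ) : ℂ)) := by fun_prop
    have := integral_inv_one_add_sq_smul_comp hd
    simp only [hK]
    rw [this]
    have e1 : z + 1 / 2 * (ζ - z) = (z + ζ) / 2 := by ring
    have e2 : z + (1 - 1 / 2) * (ζ - z) = (z + ζ) / 2 := by ring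
    rw [e1, e2]
    ring
  simp only [T, hinner]
  rw [integral_const_mul, integral_integral_swap hint]
  simp_rw [hmean]
  rw [integral_const_mul]
  simp only [gw, hg]
  ring

/-! ### Taylor coefficients -/

theorem hasSum_tay {f : ℂ → ℂ} (hf : Differentiable ℂ f) (z : ℂ) :
    HasSum (fun n => tay n f * z ^ n) (f z) := by
  have := Complex.hasSum_taylorSeries_of_entire hf 0 z
  refine this.congr_fun ?_ |> fun h => h
  intro n
  simp only [tay, sub_zero, smul_eq_mul]
  ring

theorem eq_of_tay_eq {f g : ℂ → ℂ} (hf : Differentiable ℂ f) (hg : Differentiable ℂ g)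
    (h : ∀ n, tay n f = tay n g) : f = g := by
  ext z
  have h1 := hasSum_tay hf z
  simp only [h] at h1
  exact h1.unique (hasSum_tay hg z)

theorem tay_const_mul (n : ℕ) (c : ℂ) (f : ℂ → ℂ) : tay n (fun z => c * f z) = c * tay n f := by
  rw [tay, iteratedDeriv_const_mul_field, tay, mul_div_assoc]

theorem tay_pow (n m : ℕ) : tay n (fun z => z ^ m) = if n = m then 1 else 0 := by
  have hn : (n.factorial : ℂ) ≠ 0 := by exact_mod_cast n.factorial_ne_zero
  rw [tay, iteratedDeriv_pow]
  rcases lt_trichotomy n m with h | h | h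
  · rw [if_neg h.ne, zero_pow (by omega)]; simp
  · subst h; simp [Nat.descFactorial_self, hn]
  · rw [if_neg h.ne', Nat.descFactorial_of_lt h]; simp

theorem tay_add {f g : ℂ → ℂ} (hf : Differentiable ℂ f) (hg : Differentiable ℂ g) (n : ℕ) :
    tay n (fun z => f z + g z) = tay n f + tay n g := by
  rw [tay, iteratedDeriv_fun_add hf.contDiff.contDiffAt hg.contDiff.contDiffAt, tay, tay, add_div]

theorem tay_sum_pow (s : Finset ℕ) (a : ℕ → ℂ) (n : ℕ) :
    tay n (fun z => ∑ m ∈ s, a m * z ^ m) = if n ∈ s then a n else 0 := by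
  induction s using Finset.induction_on with
  | empty => simp [tay]
  | insert m s hm ih =>
    simp only [Finset.sum_insert hm]
    rw [tay_add (by fun_prop) (by fun_prop), tay_const_mul, tay_pow, ih]
    by_cases h : n = m
    · subst h; simp [hm]
    · simp [h]

theorem iteratedDeriv_mul_pow_zero {f : ℂ → ℂ} (hf : Differentiable ℂ f) (n N : ℕ) :
    iteratedDeriv (n + N) (fun z => f z * z ^ N) 0
      = (n + N).choose N * N.factorial * iteratedDeriv n f 0 := by
  rw [iteratedDeriv_fun_mul hf.contDiff.contDiffAt (by fun_prop), Finset.sum_eq_single n]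
  · rw [Nat.add_sub_cancel_left, iteratedDeriv_pow, Nat.descFactorial_self, Nat.sub_self, pow_zero,
      Nat.choose_symm_add]
    ring
  · intro i hi hin
    have hi' : i ≤ n + N := by simpa [Nat.lt_succ_iff] using hi
    rw [iteratedDeriv_pow]
    rcases lt_or_gt_of_ne hin with h | h
    · rw [Nat.descFactorial_of_lt (by omega)]; simp
    · rw [zero_pow (by omega)]; simp
  · intro h
    exact absurd (Finset.mem_range.2 (by omega)) h

/-! ### Gaussian bounds -/

theorem GaussBound.mul {κ κ' : ℝ} {f g : ℂ → ℂ} (hf : GaussBound κ f) (hg : GaussBound κ' g) :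
    GaussBound (κ + κ') (fun z => f z * g z) := by
  obtain ⟨C, c, h⟩ := hf
  obtain ⟨D, d, h'⟩ := hg
  refine ⟨C * D, by positivity, fun z => ?_⟩
  rw [norm_mul, add_mul, Real.exp_add]
  calc _ ≤ (C * Real.exp (κ * ‖z‖ ^ 2)) * (D * Real.exp (κ' * ‖z‖ ^ 2)) := by
        gcongr
        · exact h z
        · exact h' z
    _ = _ := by ring

theorem GaussBound.conj {κ : ℝ} {f : ℂ → ℂ} (hf : GaussBound κ f) :
    GaussBound κ (fun z => (starRingEnd ℂ) (f z)) := by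
  simpa [GaussBound] using hf

theorem GaussBound.comp_midpoint {κ : ℝ} (hκ : 0 ≤ κ) {f : ℂ → ℂ} (hf : GaussBound κ f) (z : ℂ) :
    GaussBound (5 / 4 * κ) (fun ζ => f ((z + ζ) / 2)) := by
  obtain ⟨C, c, h⟩ := hf
  refine ⟨C * Real.exp (20 * κ * ‖z‖ ^ 2), by positivity, fun ζ => ?_⟩
  have := gaussBound_comp_segment hκ c h z ζ (1 / 2) (by norm_num)
  have e : z + 1 / 2 * (ζ - z) = (z + ζ) / 2 := by ring
  rwa [e] at this

theorem gaussBound_monomial {κ : ℝ} (hκ : 0 < κ) (c : ℂ) (n : ℕ) :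
    GaussBound κ (fun z => c * z ^ n) := by
  refine ⟨‖c‖ * (n.factorial * (κ⁻¹) ^ n * Real.exp κ), by positivity, fun z => ?_⟩
  rw [norm_mul, norm_pow, mul_assoc]
  gcongr
  have h1 := Real.pow_div_factorial_le_exp (κ * (1 + ‖z‖ ^ 2)) (by positivity) n
  have h2 : ‖z‖ ≤ 1 + ‖z‖ ^ 2 := by nlinarith [sq_nonneg (‖z‖ - 1)]
  have h3 : (0 : ℝ) < n.factorial := by exact_mod_cast n.factorial_pos
  calc ‖z‖ ^ n ≤ (1 + ‖z‖ ^ 2) ^ n := by gcongr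
    _ = κ⁻¹ ^ n * (κ * (1 + ‖z‖ ^ 2)) ^ n := by
      rw [← mul_pow, inv_mul_cancel_left₀ hκ.ne']
    _ ≤ κ⁻¹ ^ n * (n.factorial * Real.exp (κ * (1 + ‖z‖ ^ 2))) := by
      gcongr
      rwa [div_le_iff₀' h3] at h1
    _ = _ := by
      rw [mul_add, mul_one, Real.exp_add]; ring

theorem GaussBound.integrable {κ : ℝ} (hκ : κ < 1) {f : ℂ → ℂ} (hf : GaussBound κ f)
    (hc : Continuous f) : Integrable (fun z => f z * ((Real.exp (-‖z‖ ^ 2) : ℝ) : ℂ)) := by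
  obtain ⟨C, c, h⟩ := hf
  refine ((integrable_exp_neg_mul_norm_sq (b := 1 - κ) (by linarith)).const_mul C).mono'
    (by fun_prop) (ae_of_all _ fun z => ?_)
  rw [norm_mul, Complex.norm_real, Real.norm_eq_abs, Real.abs_exp]
  calc _ ≤ C * Real.exp (κ * ‖z‖ ^ 2) * Real.exp (-‖z‖ ^ 2) := by gcongr; exact h z
    _ = _ := by rw [mul_assoc, ← Real.exp_add]; congr 2; ring

theorem continuous_gw {f : ℂ → ℂ} (hf : Continuous f) : Continuous (gw f) := by
  unfold gw; fun_prop

theorem GaussBound.memLp {κ : ℝ} (hκ : κ < 1 / 2) {f : ℂ → ℂ} (hf : GaussBound κ f)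
    (hc : Continuous f) : MemLp (gw f) 2 := by
  rw [memLp_two_iff_integrable_sq_norm (continuous_gw hc).aestronglyMeasurable]
  have := ((hf.mul hf).integrable (by linarith) (by fun_prop)).norm
  refine this.congr (ae_of_all _ fun z => ?_)
  simp only [gw, norm_mul, Complex.norm_real, Real.norm_eq_abs, Real.abs_exp, mul_pow,
    ← Real.exp_nat_mul]
  ring_nf

/-! ### Coefficients in the basis of special Hermite functions -/

noncomputable def cst (n : ℕ) : ℝ := 1 / Real.sqrt (Real.pi * (n.factorial : ℝ))

theorem cst_pos (n : ℕ) : 0 < cst n := by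
  have : (0 : ℝ) < n.factorial := by exact_mod_cast n.factorial_pos
  have := Real.pi_pos
  unfold cst; positivity

theorem cst_mul_cst (n : ℕ) : cst n * cst n * (Real.pi * n.factorial) = 1 := by
  have : (0 : ℝ) < n.factorial := by exact_mod_cast n.factorial_pos
  have := Real.pi_pos
  unfold cst
  rw [div_mul_div_comm, Real.mul_self_sqrt (by positivity)]
  field_simp

theorem phi_eq (n : ℕ) : phi n = gw (fun z => (cst n : ℂ) * z ^ n) := rfl

theorem memLp_phi (n : ℕ) : MemLp (phi n) 2 := by
  rw [phi_eq]
  exact (gaussBound_monomial (κ := 1 / 4) (by norm_num) _ n).memLp (by norm_num) (by fun_prop)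

/-- The coefficient of `u` along `φ_n`. -/
noncomputable def coef (n : ℕ) (u : ℂ → ℂ) : ℂ := ∫ z : ℂ, u z * (starRingEnd ℂ) (phi n z)

theorem MemLp.integrable_mul_conj {u v : ℂ → ℂ} (hu : MemLp u 2) (hv : MemLp v 2) :
    Integrable (fun z => u z * (starRingEnd ℂ) (v z)) :=
  MemLp.integrable_mul hu hv.star

theorem coef_gw {f : ℂ → ℂ} (hf : Differentiable ℂ f) (h : MemLp (gw f) 2) (n : ℕ) :
    (cst n : ℂ) * coef n (gw f) = tay n f := by
  have e : ∀ z, gw f z * (starRingEnd ℂ) (phi n z) = (cst n : ℂ) *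
      (f z * (starRingEnd ℂ) z ^ n * ((Real.exp (-‖z‖ ^ 2) : ℝ) : ℂ)) := by
    intro z
    have : Real.exp (-‖z‖ ^ 2) = Real.exp (-‖z‖ ^ 2 / 2) * Real.exp (-‖z‖ ^ 2 / 2) := by
      rw [← Real.exp_add]; ring_nf
    rw [phi_eq, gw, gw, this, Complex.ofReal_mul, map_mul, map_mul, map_pow, Complex.conj_ofReal,
      Complex.conj_ofReal]
    ring
  have hi := MemLp.integrable_mul_conj h (memLp_phi n)
  have hc : (cst n : ℂ) ≠ 0 := by exact_mod_cast (cst_pos n).ne'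
  simp_rw [e] at hi
  rw [coef]
  simp_rw [e]
  rw [integral_const_mul, integral_mul_conj_pow_gaussian hf n]
  · have := congrArg (fun r : ℝ => (r : ℂ)) (cst_mul_cst n)
    push_cast at this
    linear_combination tay n f * this
  · simpa [← mul_assoc, hc] using hi.const_mul ((cst n : ℂ)⁻¹)

/-- The pointwise bound of a reproducing kernel space: f(z) is a Gaussian mean value, estimated by
Cauchy–Schwarz. -/
theorem gaussBound_of_memLp {f : ℂ → ℂ} (hf : Differentiable ℂ f) (h : MemLp (gw f) 2) :
    GaussBound (1 / 2) f := by
  have hg0 : MemLp (gw fun _ => 1) 2 := by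
    simpa using (gaussBound_monomial (κ := 1 / 4) (by norm_num) 1 0).memLp (by norm_num) (by fun_prop)
  refine ⟨Real.pi⁻¹ * ((eLpNorm (gw fun _ => 1) 2).toReal * (eLpNorm (gw f) 2).toReal),
    by have := Real.pi_pos; positivity, fun z => ?_⟩
  -- The exponential twist is entire, equals 1 at w = 0, and turns the weight e^{-|w|²} into
  -- e^{|z|²/2} e^{-|w|²/2} e^{-|w+z|²/2}, so translation acts isometrically up to the factor
  -- e^{|z|²/2}.
  set G : ℂ → ℂ := fun w => f (w + z) * Complex.exp (-(w * (starRingEnd ℂ) z)) with hG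
  have hGd : Differentiable ℂ G := by fun_prop
  have hu : MemLp (fun w => gw f (w + z)) 2 :=
    h.comp_measurePreserving (measurePreserving_add_right volume z)
  have hnorm : ∀ w, ‖G w * ((Real.exp (-‖w‖ ^ 2) : ℝ) : ℂ)‖
      = Real.exp (1 / 2 * ‖z‖ ^ 2) * ‖gw (fun _ => 1) w * gw f (w + z)‖ := by
    intro w
    simp only [hG, gw, norm_mul, Complex.norm_real, Real.norm_eq_abs, Real.abs_exp, one_mul,
      Complex.norm_exp]
    have : Real.exp (-(w * (starRingEnd ℂ) z)).re * Real.exp (-‖w‖ ^ 2) = Real.exp (1 / 2 * ‖z‖ ^ 2) *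
        Real.exp (-‖w‖ ^ 2 / 2) * Real.exp (-‖w + z‖ ^ 2 / 2) := by
      rw [← Real.exp_add, ← Real.exp_add, ← Real.exp_add]
      congr 1
      simp only [← Complex.normSq_eq_norm_sq, Complex.normSq_apply]
      simp
      ring
    linear_combination ‖f (w + z)‖ * this
  have hint : Integrable fun w => gw (fun _ => 1) w * gw f (w + z) := MemLp.integrable_mul hg0 hu
  have hi : Integrable fun w => G w * ((Real.exp (-‖w‖ ^ 2) : ℝ) : ℂ) := by
    rw [← integrable_norm_iff (by have := hGd.continuous; fun_prop)]
    simp_rw [hnorm]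
    exact hint.norm.const_mul _
  have h0 := integral_mul_conj_pow_gaussian hGd 0 (by simpa using hi)
  simp only [pow_zero, mul_one, Nat.factorial_zero, Nat.cast_one, tay, iteratedDeriv_zero, div_one] at h0
  have hG0 : G 0 = f z := by simp [hG]
  rw [hG0] at h0
  have h1 : Real.pi * ‖f z‖ ≤ Real.exp (1 / 2 * ‖z‖ ^ 2) *
      ∫ w, ‖gw (fun _ => 1) w * gw f (w + z)‖ := by
    have := norm_integral_le_integral_norm (μ := volume) fun w => G w * ((Real.exp (-‖w‖ ^ 2) : ℝ) : ℂ)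
    rw [h0, norm_mul, Complex.norm_real, Real.norm_eq_abs, abs_of_pos Real.pi_pos] at this
    simp_rw [hnorm] at this
    rwa [integral_const_mul] at this
  have h2 : ∫ w, ‖gw (fun _ => 1) w * gw f (w + z)‖
      ≤ (eLpNorm (gw fun _ => 1) 2).toReal * (eLpNorm (gw f) 2).toReal := by
    rw [integral_norm_eq_lintegral_enorm hint.aestronglyMeasurable, ← eLpNorm_one_eq_lintegral_enorm,
      ← ENNReal.toReal_mul]
    apply ENNReal.toReal_mono (ENNReal.mul_ne_top hg0.2.ne h.2.ne)
    have hcomp : eLpNorm (fun w => gw f (w + z)) 2 = eLpNorm (gw f) 2 := by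
      have hmp : MeasurePreserving (fun w : ℂ => w + z) volume volume :=
        measurePreserving_add_right volume z
      have := eLpNorm_comp_measurePreserving (p := 2) h.aestronglyMeasurable hmp
      rwa [Function.comp_def] at this
    have hmul := eLpNorm_smul_le_mul_eLpNorm (p := 2) (q := 2) (r := 1) hu.1 hg0.1
    rw [hcomp] at hmul
    exact hmul
  have hpi := Real.pi_pos
  calc ‖f z‖ = Real.pi⁻¹ * (Real.pi * ‖f z‖) := by field_simp
    _ ≤ Real.pi⁻¹ * (Real.exp (1 / 2 * ‖z‖ ^ 2) *
        ((eLpNorm (gw fun _ => 1) 2).toReal * (eLpNorm (gw f) 2).toReal)) := by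
      refine mul_le_mul_of_nonneg_left (h1.trans ?_) (by positivity)
      gcongr
    _ = _ := by ring

/-! ### The linearized operator on Taylor coefficients. -/

noncomputable def alpha (N n : ℕ) : ℝ := ((n + N).choose N : ℝ) / 2 ^ (n + N)

/-- The diagonal multiplier: `T(v, φ_N, φ_N) = T(φ_N, v, φ_N)` is diagonal. -/
noncomputable def diagSymbol (N : ℕ) (f : ℂ → ℂ) (z : ℂ) : ℂ :=
  Real.pi / N.factorial * (1 / 2) ^ N * iteratedDeriv N (fun w => f w * w ^ N) (1 / 2 * z)

theorem differentiable_iteratedDeriv {f : ℂ → ℂ} (hf : Differentiable ℂ f) (n : ℕ) :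
    Differentiable ℂ (iteratedDeriv n f) :=
  (hf.contDiff (n := n + 1)).differentiable_iteratedDeriv n (by exact_mod_cast Nat.lt_succ_self n)

theorem differentiable_diagSymbol {f : ℂ → ℂ} (hf : Differentiable ℂ f) (N : ℕ) :
    Differentiable ℂ (diagSymbol N f) := by
  have h1 : Differentiable ℂ (fun w => f w * w ^ N) := by fun_prop
  have h2 := differentiable_iteratedDeriv h1 N
  unfold diagSymbol
  fun_prop

theorem tay_diagSymbol {f : ℂ → ℂ} (hf : Differentiable ℂ f) (N n : ℕ) :
    tay n (diagSymbol N f) = Real.pi * alpha N n * tay n f := by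
  have h1 : Differentiable ℂ (fun w => f w * w ^ N) := by fun_prop
  have h2 := differentiable_iteratedDeriv h1 N
  have h3 : iteratedDeriv n (fun z => iteratedDeriv N (fun w => f w * w ^ N) (1 / 2 * z)) 0
      = (1 / 2) ^ n * iteratedDeriv (n + N) (fun w => f w * w ^ N) 0 := by
    rw [iteratedDeriv_comp_const_mul h2.contDiff]
    simp only [mul_zero]
    rw [iteratedDeriv_eq_iterate, iteratedDeriv_eq_iterate, iteratedDeriv_eq_iterate,
      Function.iterate_add_apply]
  unfold diagSymbol
  rw [tay_const_mul, tay, h3, iteratedDeriv_mul_pow_zero hf, tay, alpha]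
  have hN : (N.factorial : ℂ) ≠ 0 := by exact_mod_cast N.factorial_ne_zero
  push_cast
  simp only [pow_add, one_div, inv_pow]
  field_simp

/-- The integral against the conjugate of ζ^N extracts the N-th derivative at ζ = 0 of the function
f(w)w^N at w = (z+ζ)/2; the chain rule gives (1/2)^N and the base point z/2. -/
theorem T_diag_integral {f : ℂ → ℂ} (hf : Differentiable ℂ f) (hb : GaussBound (1 / 2) f) (N : ℕ)
    (z : ℂ) :
    Real.pi * ∫ ζ : ℂ, f ((z + ζ) / 2) * ((cst N : ℂ) * ((z + ζ) / 2) ^ N) *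
      (starRingEnd ℂ) ((cst N : ℂ) * ζ ^ N) * ((Real.exp (-‖ζ‖ ^ 2) : ℝ) : ℂ) = diagSymbol N f z := by
  have hd : Differentiable ℂ (fun w => f w * w ^ N) := by fun_prop
  have hcd : Differentiable ℂ (fun ζ => (fun w => f w * w ^ N) ((z + ζ) / 2)) := by fun_prop
  have e : ∀ ζ : ℂ, f ((z + ζ) / 2) * ((cst N : ℂ) * ((z + ζ) / 2) ^ N) *
      (starRingEnd ℂ) ((cst N : ℂ) * ζ ^ N) * ((Real.exp (-‖ζ‖ ^ 2) : ℝ) : ℂ) =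
      ((cst N * cst N : ℝ) : ℂ) * ((fun w => f w * w ^ N) ((z + ζ) / 2) * (starRingEnd ℂ) ζ ^ N *
        ((Real.exp (-‖ζ‖ ^ 2) : ℝ) : ℂ)) := by
    intro ζ
    simp only [map_mul, map_pow, Complex.conj_ofReal]
    push_cast
    ring
  -- A monomial costs an arbitrarily small Gaussian rate; 1/16 is small enough for the total, 49/64,
  -- to stay below 1.
  have hbd : GaussBound (5 / 4 * (1 / 2 + 1 / 16) + 1 / 16) (fun ζ =>
      (fun w => f w * w ^ N) ((z + ζ) / 2) * (starRingEnd ℂ) ζ ^ N) := by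
    have h1 := (gaussBound_monomial (κ := 1 / 16) (by norm_num) 1 N)
    simp only [one_mul] at h1
    have h2 := ((hb.mul h1).comp_midpoint (by norm_num) z).mul h1.conj
    simpa using h2
  have hfc := hf.continuous
  simp_rw [e]
  rw [integral_const_mul, integral_mul_conj_pow_gaussian hcd N
    (hbd.integrable (by norm_num) (by fun_prop))]
  have h3 : iteratedDeriv N (fun ζ => (fun w => f w * w ^ N) ((z + ζ) / 2)) 0
      = (1 / 2) ^ N * iteratedDeriv N (fun w => f w * w ^ N) (1 / 2 * z) := by
    set W : ℂ → ℂ := fun y => (fun w => f w * w ^ N) (1 / 2 * z + y) with hW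
    have hWd : Differentiable ℂ W := by fun_prop
    have e1 : (fun ζ => (fun w => f w * w ^ N) ((z + ζ) / 2)) = fun ζ => W (1 / 2 * ζ) := by
      ext ζ
      simp only [hW]
      have : (z + ζ) / 2 = 1 / 2 * z + 1 / 2 * ζ := by ring
      rw [this]
    rw [e1, iteratedDeriv_comp_const_mul hWd.contDiff]
    have h4 := congrFun (iteratedDeriv_comp_const_add N (fun w => f w * w ^ N) (1 / 2 * z)) 0
    rw [add_zero] at h4
    simp only [mul_zero]
    rw [hW, h4]
  rw [tay, h3, diagSymbol]
  have := congrArg (fun r : ℝ => (r : ℂ)) (cst_mul_cst N)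
  push_cast at this ⊢
  linear_combination (Real.pi * ((1 / 2) ^ N * iteratedDeriv N (fun w => f w * w ^ N) (1 / 2 * z)) /
    N.factorial) * this

theorem T_gw_phi_phi {f : ℂ → ℂ} (hf : Differentiable ℂ f) (hb : GaussBound (1 / 2) f) (N : ℕ) (z : ℂ) :
    T (gw f) (phi N) (phi N) z = gw (diagSymbol N f) z := by
  have h1 := gaussBound_monomial (κ := 1 / 16) (by norm_num) (cst N) N
  rw [phi_eq, T_gw hf (by fun_prop) (by fun_prop) hb h1 h1 (by norm_num) (by norm_num) (by norm_num)]
  simp only [gw]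
  rw [T_diag_integral hf hb]

theorem T_phi_gw_phi {f : ℂ → ℂ} (hf : Differentiable ℂ f) (hb : GaussBound (1 / 2) f) (N : ℕ) (z : ℂ) :
    T (phi N) (gw f) (phi N) z = gw (diagSymbol N f) z := by
  have h1 := gaussBound_monomial (κ := 1 / 16) (by norm_num) (cst N) N
  rw [phi_eq, T_gw (by fun_prop) hf (by fun_prop) h1 hb h1 (by norm_num) (by norm_num) (by norm_num)]
  simp only [gw]
  rw [← T_diag_integral hf hb]
  simp_rw [mul_comm (f _)]

noncomputable def offSymbol (N : ℕ) (f : ℂ → ℂ) (z : ℂ) : ℂ :=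
  ∑ n ∈ Finset.range (2 * N + 1), (Real.pi * ((2 * N).factorial / (4 ^ N * N.factorial * n.factorial)) *
    (starRingEnd ℂ) (tay (2 * N - n) f)) * z ^ n

theorem differentiable_offSymbol (N : ℕ) (f : ℂ → ℂ) : Differentiable ℂ (offSymbol N f) := by
  unfold offSymbol; fun_prop

theorem tay_offSymbol (N n : ℕ) (f : ℂ → ℂ) : tay n (offSymbol N f) =
    if n ≤ 2 * N then Real.pi * ((2 * N).factorial / (4 ^ N * N.factorial * n.factorial)) *
      (starRingEnd ℂ) (tay (2 * N - n) f) else 0 := by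
  unfold offSymbol
  rw [tay_sum_pow]
  simp

/-- Expanding (z+ζ)^{2N} binomially, the coefficient of z^n pairs ζ^{2N-n} with the conjugate of f
and so sees only the Taylor coefficient of index 2N-n. Hence the output is a polynomial times the
Gaussian. -/
theorem T_phi_phi_gw {f : ℂ → ℂ} (hf : Differentiable ℂ f) (hb : GaussBound (1 / 2) f) (N : ℕ) (z : ℂ) :
    T (phi N) (phi N) (gw f) z = gw (offSymbol N f) z := by
  have h1 := gaussBound_monomial (κ := 1 / 16) (by norm_num) (cst N) N
  rw [phi_eq, T_gw (by fun_prop) (by fun_prop) hf.continuous h1 h1 hb (by norm_num) (by norm_num)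
    (by norm_num)]
  simp only [gw]
  congr 1
  have e : ∀ ζ : ℂ, (cst N : ℂ) * ((z + ζ) / 2) ^ N * ((cst N : ℂ) * ((z + ζ) / 2) ^ N) *
      (starRingEnd ℂ) (f ζ) * ((Real.exp (-‖ζ‖ ^ 2) : ℝ) : ℂ) =
      ∑ n ∈ Finset.range (2 * N + 1), (((cst N * cst N : ℝ) : ℂ) * z ^ n * (2 * N).choose n / 4 ^ N) *
        (starRingEnd ℂ) (f ζ * (starRingEnd ℂ) ζ ^ (2 * N - n) * ((Real.exp (-‖ζ‖ ^ 2) : ℝ) : ℂ)) := by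
    intro ζ
    have : (cst N : ℂ) * ((z + ζ) / 2) ^ N * ((cst N : ℂ) * ((z + ζ) / 2) ^ N)
        = ((cst N * cst N : ℝ) : ℂ) / 4 ^ N * (z + ζ) ^ (2 * N) := by
      rw [show (4 : ℂ) = 2 * 2 by norm_num, mul_pow, pow_mul', div_pow]
      push_cast
      field_simp
    rw [this, add_pow, Finset.mul_sum, Finset.sum_mul, Finset.sum_mul]
    refine Finset.sum_congr rfl fun n _ => ?_
    simp only [map_mul, map_pow, Complex.conj_conj, Complex.conj_ofReal]
    ring
  have hi : ∀ m : ℕ, Integrable fun ζ : ℂ => f ζ * (starRingEnd ℂ) ζ ^ m *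
      ((Real.exp (-‖ζ‖ ^ 2) : ℝ) : ℂ) := by
    intro m
    have h2 := (gaussBound_monomial (κ := 1 / 16) (by norm_num) 1 m).conj
    simp only [one_mul, map_pow] at h2
    have := hf.continuous
    exact (hb.mul h2).integrable (by norm_num) (by fun_prop)
  simp_rw [e]
  rw [integral_finsetSum]
  · rw [offSymbol, Finset.mul_sum]
    refine Finset.sum_congr rfl fun n hn => ?_
    have hn' : n ≤ 2 * N := by simpa [Nat.lt_succ_iff] using hn
    rw [integral_const_mul, integral_conj, integral_mul_conj_pow_gaussian hf _ (hi _)]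
    simp only [map_mul, Complex.conj_ofReal, Complex.conj_natCast]
    have h3 := congrArg (fun r : ℝ => (r : ℂ)) (cst_mul_cst N)
    have h4 : ((2 * N).choose n : ℂ) * n.factorial * (2 * N - n).factorial = (2 * N).factorial := by
      exact_mod_cast Nat.choose_mul_factorial_mul_factorial hn'
    have hN : (N.factorial : ℂ) ≠ 0 := by exact_mod_cast N.factorial_ne_zero
    have hn0 : (n.factorial : ℂ) ≠ 0 := by exact_mod_cast n.factorial_ne_zero
    have hpi : (Real.pi : ℂ) ≠ 0 := by exact_mod_cast Real.pi_ne_zero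
    push_cast at h3 ⊢
    rw [← h4]
    have h5 : (cst N : ℂ) * cst N = 1 / (Real.pi * N.factorial) := by
      rw [eq_div_iff (by positivity)]; exact h3
    rw [h5]
    field_simp
  · intro n _
    exact ((Complex.conjLIE.toContinuousLinearEquiv.integrable_comp_iff).2 (hi _)).const_mul _

/-! ### Coefficients of L²-differentiable curves. -/

theorem T_smul (a b c : ℂ) (f₁ f₂ f₃ : ℂ → ℂ) (z : ℂ) :
    T (fun z => a * f₁ z) (fun z => b * f₂ z) (fun z => c * f₃ z) z
      = a * b * (starRingEnd ℂ) c * T f₁ f₂ f₃ z := by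
  simp only [T, ← integral_const_mul]
  congr 1; ext l; congr 1; ext x
  rw [map_mul]; ring

theorem mem_bargmannFock_iff {u : ℂ → ℂ} :
    u ∈ BargmannFock ↔ ∃ f, Differentiable ℂ f ∧ u = gw f ∧ MemLp (gw f) 2 := by
  constructor
  · rintro ⟨h, f, hf, e⟩
    have : u = gw f := funext e
    exact ⟨f, hf, this, this ▸ h⟩
  · rintro ⟨f, hf, rfl, h⟩
    exact ⟨h, f, hf, fun z => rfl⟩

theorem coef_phi (n m : ℕ) : coef n (phi m) = if n = m then 1 else 0 := by
  have hc : (cst n : ℂ) ≠ 0 := by exact_mod_cast (cst_pos n).ne'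
  have h := coef_gw (f := fun z => (cst m : ℂ) * z ^ m) (by fun_prop) (memLp_phi m) n
  rw [tay_const_mul, tay_pow, ← phi_eq] at h
  apply mul_left_cancel₀ hc
  rw [h]
  split_ifs with hnm
  · rw [hnm]
  · simp

theorem norm_coef_le {u : ℂ → ℂ} (hu : MemLp u 2) (n : ℕ) :
    ‖coef n u‖ ≤ (eLpNorm u 2).toReal * (eLpNorm (phi n) 2).toReal := by
  have hi := MemLp.integrable_mul_conj hu (memLp_phi n)
  have hconj : eLpNorm (fun z => (starRingEnd ℂ) (phi n z)) 2 = eLpNorm (phi n) 2 :=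
    eLpNorm_congr_norm_ae (ae_of_all _ fun z => by simp)
  have h := eLpNorm_smul_le_mul_eLpNorm (p := 2) (q := 2) (r := 1) (memLp_phi n).star.1 hu.1
  refine (norm_integral_le_integral_norm _).trans ?_
  rw [integral_norm_eq_lintegral_enorm hi.aestronglyMeasurable, ← eLpNorm_one_eq_lintegral_enorm,
    ← ENNReal.toReal_mul]
  apply ENNReal.toReal_mono (ENNReal.mul_ne_top hu.2.ne (memLp_phi n).2.ne)
  rw [← hconj]
  exact h

theorem coef_sub {u w : ℂ → ℂ} (hu : MemLp u 2) (hw : MemLp w 2) (n : ℕ) :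
    coef n (fun z => u z - w z) = coef n u - coef n w := by
  simp only [coef, sub_mul]
  exact integral_sub (MemLp.integrable_mul_conj hu (memLp_phi n))
    (MemLp.integrable_mul_conj hw (memLp_phi n))

theorem coef_add {u w : ℂ → ℂ} (hu : MemLp u 2) (hw : MemLp w 2) (n : ℕ) :
    coef n (fun z => u z + w z) = coef n u + coef n w := by
  simp only [coef, add_mul]
  exact integral_add (MemLp.integrable_mul_conj hu (memLp_phi n))
    (MemLp.integrable_mul_conj hw (memLp_phi n))

theorem coef_const_mul (c : ℂ) (u : ℂ → ℂ) (n : ℕ) :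
    coef n (fun z => c * u z) = c * coef n u := by
  simp only [coef, mul_assoc, integral_const_mul]

/-- The definition of the derivative does not ask that w be in L²; this follows because w is at
finite L² distance from a difference quotient. -/
theorem HasL2DerivAt.memLp {v : ℝ → ℂ → ℂ} {w : ℂ → ℂ} {t : ℝ} (h : HasL2DerivAt v w t)
    (hv : ∀ s, MemLp (v s) 2) (hw : AEStronglyMeasurable w volume) : MemLp w 2 := by
  have h1 : ∀ᶠ s : ℝ in 𝓝[≠] 0, eLpNorm (fun z : ℂ => (v (t + s) z - v t z) / (s : ℂ) - w z) 2 < 1 :=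
    h.eventually (gt_mem_nhds one_pos)
  obtain ⟨s, hs⟩ := h1.exists
  have hq : MemLp (fun z => (v (t + s) z - v t z) / (s : ℂ)) 2 := by
    simpa [div_eq_inv_mul] using ((hv (t + s)).sub (hv t)).const_mul ((s : ℂ)⁻¹)
  have hd : MemLp (fun z => (v (t + s) z - v t z) / (s : ℂ) - w z) 2 :=
    ⟨hq.1.sub hw, hs.trans ENNReal.one_lt_top⟩
  exact (hq.sub hd).ae_eq (ae_of_all _ fun z => by simp)

theorem HasL2DerivAt.hasDerivAt_coef {v : ℝ → ℂ → ℂ} {w : ℂ → ℂ} {t : ℝ} (h : HasL2DerivAt v w t)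
    (hv : ∀ s, MemLp (v s) 2) (hw : MemLp w 2) (n : ℕ) :
    HasDerivAt (fun s => coef n (v s)) (coef n w) t := by
  rw [hasDerivAt_iff_tendsto_slope_zero, tendsto_iff_norm_sub_tendsto_zero]
  have hq : ∀ s : ℝ, MemLp (fun z => (v (t + s) z - v t z) / (s : ℂ)) 2 := fun s => by
    simpa [div_eq_inv_mul] using ((hv (t + s)).sub (hv t)).const_mul ((s : ℂ)⁻¹)
  have he : ∀ s : ℝ, s⁻¹ • (coef n (v (t + s)) - coef n (v t)) - coef n w
      = coef n (fun z => (v (t + s) z - v t z) / (s : ℂ) - w z) := by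
    intro s
    rw [coef_sub (hq s) hw]
    simp only [div_eq_inv_mul]
    rw [coef_const_mul, coef_sub (hv _) (hv _), Complex.real_smul, Complex.ofReal_inv]
  simp_rw [he]
  unfold HasL2DerivAt at h
  have h1 := ((ENNReal.tendsto_toReal ENNReal.zero_ne_top).comp h).mul_const (eLpNorm (phi n) 2).toReal
  rw [ENNReal.toReal_zero, zero_mul] at h1
  exact squeeze_zero (fun _ => norm_nonneg _) (fun s => norm_coef_le ((hq s).sub hw) n) h1

theorem hasL2DerivAt_sum_phi (s : Finset ℕ) {y : ℕ → ℝ → ℂ} {y' : ℕ → ℂ} {t : ℝ}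
    (hy : ∀ n ∈ s, HasDerivAt (y n) (y' n) t) :
    HasL2DerivAt (fun t z => ∑ n ∈ s, y n t * phi n z) (fun z => ∑ n ∈ s, y' n * phi n z) t := by
  unfold HasL2DerivAt
  have h0 : Tendsto (fun h : ℝ => ∑ n ∈ s, ‖(h⁻¹ • (y n (t + h) - y n t) - y' n)‖ₑ * eLpNorm (phi n) 2)
      (𝓝[≠] 0) (𝓝 0) := by
    rw [show (0 : ENNReal) = ∑ n ∈ s, 0 by simp]
    refine tendsto_finsetSum _ fun n hn => ?_
    have h1 := (hasDerivAt_iff_tendsto_slope_zero.1 (hy n hn)).sub_const (y' n)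
    rw [sub_self] at h1
    have h2 := h1.enorm
    rw [enorm_zero] at h2
    simpa using ENNReal.Tendsto.mul_const h2 (Or.inr (memLp_phi n).2.ne)
  refine tendsto_of_tendsto_of_tendsto_of_le_of_le tendsto_const_nhds h0 (fun _ => zero_le) fun h => ?_
  have he : (fun z => ((∑ n ∈ s, y n (t + h) * phi n z) - ∑ n ∈ s, y n t * phi n z) / (h : ℂ)
      - ∑ n ∈ s, y' n * phi n z)
      = ∑ n ∈ s, (h⁻¹ • (y n (t + h) - y n t) - y' n) • phi n := by
    ext z
    rw [← Finset.sum_sub_distrib, Finset.sum_div, ← Finset.sum_sub_distrib, Finset.sum_apply]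
    refine Finset.sum_congr rfl fun n _ => ?_
    simp only [Pi.smul_apply, smul_eq_mul, Complex.real_smul, Complex.ofReal_inv]
    ring
  rw [he]
  refine (eLpNorm_sum_le (fun n _ => ((memLp_phi n).const_smul _).1) (by norm_num)).trans ?_
  exact Finset.sum_le_sum fun n _ => (eLpNorm_const_smul _ _ _ _).le

/-! ### Parseval -/

noncomputable def phiLp (n : ℕ) : Lp ℂ 2 (volume : Measure ℂ) := (memLp_phi n).toLp

theorem inner_phiLp {u : ℂ → ℂ} (hu : MemLp u 2) (n : ℕ) :
    inner ℂ (phiLp n) (hu.toLp) = coef n u := by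
  rw [L2.inner_def, coef]
  refine integral_congr_ae ?_
  filter_upwards [(memLp_phi n).coeFn_toLp, hu.coeFn_toLp] with z h1 h2
  rw [phiLp, h1, h2]
  simp

theorem orthonormal_phiLp : Orthonormal ℂ phiLp := by
  rw [orthonormal_iff_ite]
  intro i j
  rw [phiLp, phiLp, ← phiLp, inner_phiLp, coef_phi]

theorem sum_sq_coef_le {u : ℂ → ℂ} (hu : MemLp u 2) (s : Finset ℕ) :
    ∑ n ∈ s, ‖coef n u‖ ^ 2 ≤ (eLpNorm u 2).toReal ^ 2 := by
  have := orthonormal_phiLp.sum_inner_products_le (hu.toLp) (s := s)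
  simp only [inner_phiLp, Lp.norm_toLp] at this
  exact this

theorem eLpNorm_sum_phi (s : Finset ℕ) (a : ℕ → ℂ) :
    eLpNorm (fun z => ∑ n ∈ s, a n * phi n z) 2 = ENNReal.ofReal (Real.sqrt (∑ n ∈ s, ‖a n‖ ^ 2)) := by
  have hm : MemLp (fun z => ∑ n ∈ s, a n * phi n z) 2 :=
    memLp_finsetSum s fun n _ => (memLp_phi n).const_mul (a n)
  have h1 : hm.toLp = ∑ n ∈ s, a n • phiLp n := by
    apply Lp.ext
    have h2 : ∀ᵐ z, ∀ n ∈ s, (a n • phiLp n : Lp ℂ 2 (volume : Measure ℂ)) z = a n * phi n z := by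
      refine (Filter.eventually_all_finset s).2 fun n _ => ?_
      filter_upwards [Lp.coeFn_smul (a n) (phiLp n), (memLp_phi n).coeFn_toLp] with z e1 e2
      rw [e1, Pi.smul_apply, phiLp, e2, smul_eq_mul]
    have h3 := Lp.coeFn_finsetSum s (fun n => a n • phiLp n)
    filter_upwards [hm.coeFn_toLp, h2, h3] with z e1 e2 e3
    rw [e1, e3, Finset.sum_apply]
    exact Finset.sum_congr rfl fun n hn => (e2 n hn).symm
  have h4 : ‖hm.toLp‖ ^ 2 = ∑ n ∈ s, ‖a n‖ ^ 2 := by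
    rw [h1, ← inner_self_eq_norm_sq (𝕜 := ℂ), orthonormal_phiLp.inner_sum]
    rw [map_sum]
    refine Finset.sum_congr rfl fun n _ => ?_
    rw [RCLike.conj_mul]
    norm_cast
  rw [← h4, Real.sqrt_sq (norm_nonneg _), Lp.norm_toLp, ENNReal.ofReal_toReal hm.2.ne]

/-- The partial sums of the Taylor series converge pointwise to u, so Fatou's lemma replaces the
completeness of the system φ_n. -/
theorem eLpNorm_le_of_sum_sq_coef_le {u : ℂ → ℂ} (hu : u ∈ BargmannFock) {M : ℝ}
    (hM : ∀ k, ∑ n ∈ Finset.range k, ‖coef n u‖ ^ 2 ≤ M) :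
    (eLpNorm u 2).toReal ≤ Real.sqrt M := by
  obtain ⟨f, hf, rfl, hL⟩ := mem_bargmannFock_iff.1 hu
  have hlim : ∀ z, Tendsto (fun k => ∑ n ∈ Finset.range k, coef n (gw f) * phi n z) atTop (𝓝 (gw f z)) := by
    intro z
    have := ((hasSum_tay hf z).tendsto_sum_nat).mul_const ((Real.exp (-‖z‖ ^ 2 / 2) : ℝ) : ℂ)
    refine this.congr fun k => ?_
    rw [Finset.sum_mul]
    refine Finset.sum_congr rfl fun n _ => ?_
    rw [← coef_gw hf hL, phi_eq, gw]
    ring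
  have hm : ∀ k, AEStronglyMeasurable (fun z => ∑ n ∈ Finset.range k, coef n (gw f) * phi n z) volume :=
    fun k => (memLp_finsetSum _ fun n _ => (memLp_phi n).const_mul _).1
  have hle := Lp.eLpNorm_lim_le_liminf_eLpNorm (p := 2) hm (gw f) (ae_of_all _ hlim)
  apply ENNReal.toReal_le_of_le_ofReal (Real.sqrt_nonneg _)
  refine hle.trans (liminf_le_of_le (by isBoundedDefault) fun b hb => ?_)
  obtain ⟨k, hk⟩ := hb.exists
  refine hk.trans ?_
  rw [eLpNorm_sum_phi]
  exact ENNReal.ofReal_le_ofReal (Real.sqrt_le_sqrt (hM k))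

/-! ### The linearization as a system for the coefficients. -/

/-- The coupling coefficient between the modes `n` and `2N - n`. -/
noncomputable def beta (N n : ℕ) : ℝ :=
  if n ≤ 2 * N then ((2 * N).factorial / (4 ^ N * N.factorial)) * Real.pi * cst n * cst (2 * N - n) else 0

noncomputable def phase (N : ℕ) (t : ℝ) : ℂ := Complex.exp (-(Complex.I * (omega N : ℂ) * (t : ℂ)))

theorem phase_ne_zero (N : ℕ) (t : ℝ) : phase N t ≠ 0 := Complex.exp_ne_zero _

theorem conj_phase (N : ℕ) (t : ℝ) : (starRingEnd ℂ) (phase N t) = (phase N t)⁻¹ := by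
  rw [phase, ← Complex.exp_conj, ← Complex.exp_neg]
  simp

theorem norm_phase (N : ℕ) (t : ℝ) : ‖phase N t‖ = 1 := by
  rw [phase, Complex.norm_exp]; simp

theorem hasDerivAt_phase (N : ℕ) (t : ℝ) :
    HasDerivAt (phase N) (-(Complex.I * omega N) * phase N t) t := by
  have h1 : HasDerivAt (fun s : ℝ => -(Complex.I * (omega N : ℂ) * (s : ℂ))) (-(Complex.I * omega N)) t := by
    simpa using ((Complex.ofRealCLM.hasDerivAt (x := t)).const_mul (Complex.I * (omega N : ℂ))).fun_neg
  exact h1.cexp.congr_deriv (mul_comm _ _)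

theorem wave_eq (N : ℕ) (t : ℝ) : wave N t = fun z => phase N t * phi N z := rfl

theorem diagSymbol_monomial (N n : ℕ) (c : ℂ) :
    diagSymbol N (fun z => c * z ^ n) = fun z => Real.pi * alpha N n * (c * z ^ n) := by
  apply eq_of_tay_eq (differentiable_diagSymbol (by fun_prop) N) (by fun_prop)
  intro k
  rw [tay_diagSymbol (by fun_prop)]
  simp only [tay_const_mul, tay_pow]
  split_ifs with h
  · rw [h]
  · simp

theorem T_phi_phi_phi (N : ℕ) (z : ℂ) :
    T (phi N) (phi N) (phi N) z = Real.pi * alpha N N * phi N z := by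
  have h := T_gw_phi_phi (f := fun z => (cst N : ℂ) * z ^ N) (by fun_prop)
    (gaussBound_monomial (by norm_num) _ _) N z
  rw [← phi_eq] at h
  rw [h, diagSymbol_monomial, phi_eq, gw, gw]
  ring

theorem omega_eq (N : ℕ) : omega N = Real.pi * alpha N N := by
  have h : E (phi N) (phi N) (phi N) (phi N) = ((Real.pi * alpha N N : ℝ) : ℂ) := by
    simp only [E, T_phi_phi_phi, mul_assoc]
    rw [integral_const_mul, integral_const_mul]
    have := coef_phi N N
    rw [coef, if_pos rfl] at this
    rw [this]
    push_cast; ring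
  rw [omega, energy, h, Complex.ofReal_re]

theorem wave_mem (N : ℕ) (t : ℝ) : wave N t ∈ BargmannFock := by
  refine mem_bargmannFock_iff.2 ⟨fun z => phase N t * (cst N * z ^ N), by fun_prop, ?_, ?_⟩
  · ext z
    simp only [wave_eq, phi_eq, gw, mul_assoc]
  · have : gw (fun z => phase N t * (cst N * z ^ N)) = fun z => phase N t * phi N z := by
      ext z; rw [phi_eq, gw, gw, mul_assoc]
    rw [this]
    exact (memLp_phi N).const_mul _

theorem isSolution_wave (N : ℕ) : IsSolution (wave N) := by
  refine ⟨wave_mem N, fun t => ?_⟩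
  have h := hasL2DerivAt_sum_phi {N} (y := fun _ => phase N)
    (y' := fun _ => -(Complex.I * omega N) * phase N t) (fun n _ => hasDerivAt_phase N t)
  simp only [Finset.sum_singleton] at h
  have e : (fun z => -Complex.I * T (wave N t) (wave N t) (wave N t) z)
      = fun z => -(Complex.I * omega N) * phase N t * phi N z := by
    ext z
    rw [wave_eq, T_smul, T_phi_phi_phi, conj_phase, omega_eq]
    have := phase_ne_zero N t
    push_cast
    field_simp
  rw [e]
  exact h

/-- The right-hand side of the linearized equation, in terms of entire functions. -/
noncomputable def linSymbol (N : ℕ) (t : ℝ) (f : ℂ → ℂ) (z : ℂ) : ℂ :=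
  -Complex.I * (2 * diagSymbol N f z + phase N t ^ 2 * offSymbol N f z)

theorem differentiable_linSymbol {f : ℂ → ℂ} (hf : Differentiable ℂ f) (N : ℕ) (t : ℝ) :
    Differentiable ℂ (linSymbol N t f) := by
  have h1 := differentiable_diagSymbol hf N
  have h2 := differentiable_offSymbol N f
  unfold linSymbol
  fun_prop

theorem linearization_eq {f : ℂ → ℂ} (hf : Differentiable ℂ f) (hb : GaussBound (1 / 2) f) (N : ℕ)
    (t : ℝ) :
    (fun z => -Complex.I * (T (gw f) (wave N t) (wave N t) z + T (wave N t) (gw f) (wave N t) z +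
      T (wave N t) (wave N t) (gw f) z)) = gw (linSymbol N t f) := by
  ext z
  have hp := phase_ne_zero N t
  have h1 := T_smul 1 (phase N t) (phase N t) (gw f) (phi N) (phi N) z
  have h2 := T_smul (phase N t) 1 (phase N t) (phi N) (gw f) (phi N) z
  have h3 := T_smul (phase N t) (phase N t) 1 (phi N) (phi N) (gw f) z
  simp only [one_mul] at h1 h2 h3
  rw [wave_eq, h1, h2, h3, T_gw_phi_phi hf hb, T_phi_gw_phi hf hb, T_phi_phi_gw hf hb, conj_phase]
  simp only [gw, linSymbol, map_one]
  field_simp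
  ring

theorem tay_linSymbol {f : ℂ → ℂ} (hf : Differentiable ℂ f) {x : ℕ → ℂ}
    (hx : ∀ n, tay n f = cst n * x n) (N : ℕ) (t : ℝ) (n : ℕ) :
    tay n (linSymbol N t f) = cst n * (-Complex.I * Real.pi * (2 * alpha N n * x n +
      phase N t ^ 2 * (beta N n * (starRingEnd ℂ) (x (2 * N - n))))) := by
  have h1 := differentiable_diagSymbol hf N
  have h2 := differentiable_offSymbol N f
  unfold linSymbol
  rw [tay_const_mul, tay_add (by fun_prop) (by fun_prop), tay_const_mul, tay_const_mul,
    tay_diagSymbol hf, tay_offSymbol, hx, hx, beta]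
  split_ifs with h
  · have h3 := congrArg (fun r : ℝ => (r : ℂ)) (cst_mul_cst n)
    have hn : (n.factorial : ℂ) ≠ 0 := by exact_mod_cast n.factorial_ne_zero
    have hN : (N.factorial : ℂ) ≠ 0 := by exact_mod_cast N.factorial_ne_zero
    have hpi : (Real.pi : ℂ) ≠ 0 := by exact_mod_cast Real.pi_ne_zero
    push_cast at h3 ⊢
    have h5 : (1 : ℂ) / n.factorial = Real.pi * (cst n * cst n) := by
      rw [div_eq_iff hn]; linear_combination -h3
    have h6 : ((2 * N).factorial : ℂ) / (4 ^ N * N.factorial * n.factorial)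
        = (2 * N).factorial / (4 ^ N * N.factorial) * (1 / n.factorial) := by
      field_simp
    rw [h6, h5, map_mul, Complex.conj_ofReal]
    ring
  · simp; ring

/-- The `n`-th coefficient of a curve, in the frame rotating with the wave. -/
noncomputable def rotCoef (N : ℕ) (v : ℝ → ℂ → ℂ) (n : ℕ) (t : ℝ) : ℂ :=
  (phase N t)⁻¹ * coef n (v t)

/-- The rotating frame absorbs the factor `phase N t ^ 2` of the conjugate term and makes the system
autonomous, at the price of the shift -α_N. For n > 2N the truncated index 2N-n is 0, which is
harmless since β vanishes there. -/
theorem hasDerivAt_rotCoef {N : ℕ} {v : ℝ → ℂ → ℂ} (hv : IsLinearizedSolution N v) (n : ℕ) (t : ℝ) :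
    HasDerivAt (rotCoef N v n) (-Complex.I * Real.pi * ((2 * alpha N n - alpha N N) * rotCoef N v n t +
      beta N n * (starRingEnd ℂ) (rotCoef N v (2 * N - n) t))) t := by
  obtain ⟨f, hf, hfv, hL⟩ := mem_bargmannFock_iff.1 (hv.1 t)
  have hmem : ∀ s, MemLp (v s) 2 := fun s => (hv.1 s).1
  have h := hv.2 t
  rw [hfv, linearization_eq hf (gaussBound_of_memLp hf hL)] at h
  have hd := differentiable_linSymbol hf N t
  have hm := h.memLp hmem (continuous_gw hd.continuous).aestronglyMeasurable
  have hc := h.hasDerivAt_coef hmem hm n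
  have hcn : (cst n : ℂ) ≠ 0 := by exact_mod_cast (cst_pos n).ne'
  have e : coef n (gw (linSymbol N t f)) = -Complex.I * Real.pi * (2 * alpha N n * coef n (v t) +
      phase N t ^ 2 * (beta N n * (starRingEnd ℂ) (coef (2 * N - n) (v t)))) := by
    apply mul_left_cancel₀ hcn
    rw [coef_gw hd hm, tay_linSymbol hf (x := fun n => coef n (v t))]
    intro k
    rw [hfv, coef_gw hf hL]
  rw [e] at hc
  have hp := phase_ne_zero N t
  have h2 : HasDerivAt (rotCoef N v n) _ t := ((hasDerivAt_phase N t).inv hp).mul hc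
  refine h2.congr_deriv ?_
  simp only [rotCoef, map_mul, map_inv₀, conj_phase, omega_eq, Pi.inv_apply]
  push_cast
  field_simp
  ring

/-- A converse for finitely many modes, used to build the unstable solutions. -/
theorem isLinearizedSolution_sum_phi (N : ℕ) (s : Finset ℕ) (y : ℕ → ℝ → ℂ)
    (hs : ∀ n ∉ s, ∀ t, y n t = 0)
    (hy : ∀ n t, HasDerivAt (y n) (-Complex.I * Real.pi * (2 * alpha N n * y n t +
      phase N t ^ 2 * (beta N n * (starRingEnd ℂ) (y (2 * N - n) t)))) t) :
    IsLinearizedSolution N (fun t z => ∑ n ∈ s, y n t * phi n z) := by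
  have hgw : ∀ a : ℕ → ℂ, (fun z => ∑ n ∈ s, a n * phi n z)
      = gw (fun z => ∑ n ∈ s, (a n * cst n) * z ^ n) := by
    intro a
    ext z
    rw [gw, Finset.sum_mul]
    refine Finset.sum_congr rfl fun n _ => ?_
    rw [phi_eq, gw]; ring
  have hLp : ∀ a : ℕ → ℂ, MemLp (fun z => ∑ n ∈ s, a n * phi n z) 2 := fun a =>
    memLp_finsetSum s fun n _ => (memLp_phi n).const_mul (a n)
  have hmem : ∀ a : ℕ → ℂ, (fun z => ∑ n ∈ s, a n * phi n z) ∈ BargmannFock := fun a =>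
    mem_bargmannFock_iff.2 ⟨fun z => ∑ n ∈ s, (a n * cst n) * z ^ n, by fun_prop, hgw a,
      by rw [← hgw a]; exact hLp a⟩
  refine ⟨fun t => hmem fun n => y n t, fun t => ?_⟩
  have h := hasL2DerivAt_sum_phi s (fun n _ => hy n t)
  set f : ℂ → ℂ := fun z => ∑ n ∈ s, (y n t * cst n) * z ^ n with hf
  have hfd : Differentiable ℂ f := by fun_prop
  have hv : (fun z => ∑ n ∈ s, y n t * phi n z) = gw f := hgw fun n => y n t
  have hb : GaussBound (1 / 2) f := gaussBound_of_memLp hfd (by rw [← hv]; exact hLp _)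
  have e : gw (linSymbol N t f) = fun z => ∑ n ∈ s, (-Complex.I * Real.pi * (2 * alpha N n * y n t +
      phase N t ^ 2 * (beta N n * (starRingEnd ℂ) (y (2 * N - n) t)))) * phi n z := by
    rw [hgw]
    congr 1
    apply eq_of_tay_eq (differentiable_linSymbol hfd N t) (by fun_prop)
    intro n
    rw [tay_sum_pow, tay_linSymbol hfd (x := fun n => y n t)]
    · split_ifs with hn
      · ring
      -- Outside s the equation for the zero coefficient forces its right-hand side to vanish, so
      -- the linearization does not leave the span.
      · have h0 : y n = fun _ => 0 := funext fun t => hs n hn t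
        have h1 := hy n t
        rw [h0] at h1
        have h2 := h1.unique (hasDerivAt_const t (0 : ℂ))
        simp only [h0]
        rw [h2, mul_zero]
    · intro k
      rw [hf, tay_sum_pow]
      split_ifs with hk
      · ring
      · rw [hs k hk, mul_zero]
  simp only [hv]
  rw [linearization_eq hfd hb, e]
  exact h

/-! ### The mode equations -/

theorem mul_sqrt_sub_of_sq_eq {X : ℂ} (hX : 0 < X.re) {e d : ℝ}
    (h : (X + Complex.I * e) ^ 2 = (d : ℂ)) :
    0 < d ∧ X = Real.sqrt d - Complex.I * e := by
  have hre := congrArg Complex.re h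
  have him := congrArg Complex.im h
  simp [pow_two] at hre him
  have h0 : X.im + e = 0 := by
    have : X.re * (X.im + e) = 0 := by linarith
    rcases mul_eq_zero.1 this with h1 | h1
    · exact absurd h1 hX.ne'
    · exact h1
  rw [h0] at hre
  have hd : d = X.re ^ 2 := by linarith
  refine ⟨by rw [hd]; positivity, ?_⟩
  rw [hd, Real.sqrt_sq hX.le]
  apply Complex.ext
  · simp
  · simp; linarith

theorem hasDerivAt_cexp_mul (μ : ℂ) (t : ℝ) :
    HasDerivAt (fun s : ℝ => Complex.exp (μ * s)) (μ * Complex.exp (μ * t)) t := by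
  have h1 : HasDerivAt (fun s : ℝ => μ * (s : ℂ)) μ t := by
    simpa using (Complex.ofRealCLM.hasDerivAt (x := t)).const_mul μ
  exact h1.cexp.congr_deriv (mul_comm _ _)

theorem hasDerivAt_sum_cexp (μ ν a b : ℂ) (t : ℝ) :
    HasDerivAt (fun s : ℝ => Complex.exp (μ * s) * a + Complex.exp (ν * s) * b)
      (Complex.exp (μ * t) * (μ * a) + Complex.exp (ν * t) * (ν * b)) t :=
  (((hasDerivAt_cexp_mul μ t).mul_const a).add ((hasDerivAt_cexp_mul ν t).mul_const b)).congr_deriv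
    (by ring)

/-- Eliminating y gives (d/dt + ie)² x = D x with e = π(A-A')/2 and D = π²(B² - ((A+A')/2)²). An
exponent with positive real part and nonzero amplitude must be √D - ie with D > 0. So it depends
only on the pair, not on the mode, and x has a single complex parameter. -/
theorem growing_pair {A A' B : ℝ} {μ a b : ℂ} (hμ : 0 < μ.re) {x y : ℝ → ℂ}
    (hx : ∀ t, x t = Complex.exp (μ * t) * a + Complex.exp ((starRingEnd ℂ) μ * t) * b)
    (hdx : ∀ t, HasDerivAt x (-Complex.I * Real.pi * (A * x t + B * (starRingEnd ℂ) (y t))) t)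
    (hdy : ∀ t, HasDerivAt y (-Complex.I * Real.pi * (A' * y t + B * (starRingEnd ℂ) (x t))) t) :
    ∃ p : ℂ, (B ^ 2 - ((A + A') / 2) ^ 2 ≤ 0 → p = 0) ∧ ∀ t : ℝ, x t = Complex.exp
      ((Real.sqrt (Real.pi ^ 2 * (B ^ 2 - ((A + A') / 2) ^ 2)) - Complex.I *
        (Real.pi * (A - A') / 2 : ℝ)) * t) * p := by
  set ν := (starRingEnd ℂ) μ with hν
  set D := Real.pi ^ 2 * (B ^ 2 - ((A + A') / 2) ^ 2) with hD
  set e : ℝ := Real.pi * (A - A') / 2 with he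
  have hνre : 0 < ν.re := by simpa [hν] using hμ
  have hxf : x = fun t : ℝ => Complex.exp (μ * t) * a + Complex.exp (ν * t) * b := funext hx
  have hx1 : ∀ t : ℝ, HasDerivAt x (Complex.exp (μ * t) * (μ * a) + Complex.exp (ν * t) * (ν * b)) t := by
    intro t; rw [hxf]; exact hasDerivAt_sum_cexp μ ν a b t
  have e1 : (fun t : ℝ => Complex.exp (μ * t) * (μ * a) + Complex.exp (ν * t) * (ν * b))
      = fun t => -Complex.I * Real.pi * (A * x t + B * (starRingEnd ℂ) (y t)) :=
    funext fun t => (hx1 t).unique (hdx t)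
  have e2 : ∀ t : ℝ, Complex.exp (μ * t) * (μ * (μ * a)) + Complex.exp (ν * t) * (ν * (ν * b))
      = -Complex.I * Real.pi * (A * (-Complex.I * Real.pi * (A * x t + B * (starRingEnd ℂ) (y t))) +
        B * (starRingEnd ℂ) (-Complex.I * Real.pi * (A' * y t + B * (starRingEnd ℂ) (x t)))) := by
    intro t
    have h1 := hasDerivAt_sum_cexp μ ν (μ * a) (ν * b) t
    rw [e1] at h1
    exact h1.unique ((((hdx t).const_mul _).add ((hdy t).star.const_mul _)).const_mul _)
  have e3 : ∀ t : ℝ, Complex.exp (μ * t) * (((μ + Complex.I * e) ^ 2 - D) * a) +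
      Complex.exp (ν * t) * (((ν + Complex.I * e) ^ 2 - D) * b) = 0 := by
    intro t
    have h1 := congrFun e1 t
    have h2 := e2 t
    simp only [map_mul, map_neg, Complex.conj_I, map_add, Complex.conj_ofReal, Complex.conj_conj] at h2
    rw [hx t] at h1 h2
    simp only [hD, he]
    push_cast
    linear_combination h2 + (Complex.I * Real.pi * (A - A')) * h1 + (Real.pi ^ 2 *
      ((A + A') ^ 2 / 4 - B ^ 2) * (Complex.exp (μ * t) * a + Complex.exp (ν * t) * b)) * Complex.I_sq
  -- The value and the derivative of `e3` at 0 form a Vandermonde system, which separates the two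
  -- exponentials when μ ≠ ν. When μ = ν only a + b is determined.
  have e4 : μ * (((μ + Complex.I * e) ^ 2 - D) * a) + ν * (((ν + Complex.I * e) ^ 2 - D) * b) = 0 := by
    have h1 := hasDerivAt_sum_cexp μ ν (((μ + Complex.I * e) ^ 2 - D) * a)
      (((ν + Complex.I * e) ^ 2 - D) * b) 0
    rw [funext e3] at h1
    have := h1.unique (hasDerivAt_const (0 : ℝ) (0 : ℂ))
    simpa using this
  have e5 := e3 0
  simp only [Complex.ofReal_zero, mul_zero, Complex.exp_zero, one_mul] at e5
  have hroot : ∀ X : ℂ, 0 < X.re → (X + Complex.I * e) ^ 2 - D = 0 →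
      0 < B ^ 2 - ((A + A') / 2) ^ 2 ∧ X = Real.sqrt D - Complex.I * e := by
    intro X hX h
    obtain ⟨h1, h2⟩ := mul_sqrt_sub_of_sq_eq hX (sub_eq_zero.1 h)
    exact ⟨by simpa [hD, Real.pi_pos] using h1, h2⟩
  have key : ∀ X c : ℂ, 0 < X.re → ((X + Complex.I * e) ^ 2 - D) * c = 0 →
      (B ^ 2 - ((A + A') / 2) ^ 2 ≤ 0 → c = 0) ∧ (c = 0 ∨ X = Real.sqrt D - Complex.I * e) := by
    intro X c hX h
    rcases mul_eq_zero.1 h with h | h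
    · obtain ⟨h1, h2⟩ := hroot X hX h
      exact ⟨fun h3 => absurd h1 (not_lt.2 h3), Or.inr h2⟩
    · exact ⟨fun _ => h, Or.inl h⟩
  have hgen : ∀ X c : ℂ, (c = 0 ∨ X = Real.sqrt D - Complex.I * e) → ∀ t : ℝ,
      Complex.exp (X * t) * c = Complex.exp ((Real.sqrt D - Complex.I * e) * t) * c := by
    rintro X c (h | h) t
    · simp [h]
    · rw [h]
  refine ⟨a + b, ?_⟩
  by_cases hμν : μ = ν
  · rw [← hμν] at e5
    obtain ⟨k1, k2⟩ := key μ (a + b) hμ (by linear_combination e5)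
    refine ⟨k1, fun t => ?_⟩
    rw [hx, ← hμν, ← mul_add, hgen μ _ k2]
  · have hsub : μ - ν ≠ 0 := sub_ne_zero.2 hμν
    obtain ⟨k1, k2⟩ := key μ a hμ (by
      apply mul_left_cancel₀ hsub; linear_combination e4 - ν * e5)
    obtain ⟨k3, k4⟩ := key ν b hνre (by
      apply mul_left_cancel₀ hsub; linear_combination μ * e5 - e4)
    refine ⟨fun h => by rw [k1 h, k3 h, add_zero], fun t => ?_⟩
    rw [hx, hgen μ _ k2, hgen ν _ k4, mul_add]

theorem eq_of_hasDerivAt_zero {f : ℝ → ℂ} (h : ∀ t, HasDerivAt f 0 t) (t : ℝ) : f t = f 0 :=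
  is_const_of_deriv_eq_zero (fun t => (h t).differentiableAt) (fun t => (h t).deriv) t 0

theorem norm_eq_of_decoupled {A : ℝ} {x : ℝ → ℂ}
    (hdx : ∀ t, HasDerivAt x (-Complex.I * Real.pi * (A * x t)) t) (t : ℝ) : ‖x t‖ = ‖x 0‖ := by
  have h : ∀ t, HasDerivAt (fun t : ℝ => Complex.exp ((Complex.I * Real.pi * A) * t) * x t) 0 t := fun t =>
    ((hasDerivAt_cexp_mul _ t).mul (hdx t)).congr_deriv (by ring)
  have h1 := congrArg norm (eq_of_hasDerivAt_zero h t)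
  simpa [Complex.norm_exp] using h1

/-- The real part of x is conserved, so the derivative of x is constant. This is the Jordan block of
the mode n = N. -/
theorem norm_le_of_degenerate {A : ℝ} {x : ℝ → ℂ}
    (hdx : ∀ t, HasDerivAt x (-Complex.I * Real.pi * (A * x t + A * (starRingEnd ℂ) (x t))) t) :
    ∃ C, ∀ t, 0 ≤ t → ‖x t‖ ≤ C * (1 + t) := by
  have h : ∀ t, HasDerivAt (fun t : ℝ => x t + (starRingEnd ℂ) (x t)) 0 t := fun t =>
    ((hdx t).add (hdx t).star).congr_deriv (by
      simp only [← starRingEnd_apply, map_mul, map_neg, Complex.conj_I, map_add, Complex.conj_ofReal,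
        Complex.conj_conj]
      ring)
  have hc := eq_of_hasDerivAt_zero h
  set c := x 0 + (starRingEnd ℂ) (x 0) with hcdef
  have h2 : ∀ t : ℝ, HasDerivAt (fun t : ℝ => x t + (Complex.I * Real.pi * A * c) * t) 0 t := by
    intro t
    have h3 : HasDerivAt (fun t : ℝ => (Complex.I * Real.pi * A * c) * (t : ℂ)) (Complex.I * Real.pi * A * c) t := by
      simpa using (Complex.ofRealCLM.hasDerivAt (x := t)).const_mul (Complex.I * Real.pi * A * c)
    refine ((hdx t).add h3).congr_deriv ?_
    linear_combination (-Complex.I * Real.pi * A) * hc t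
  have h3 := eq_of_hasDerivAt_zero h2
  refine ⟨‖x 0‖ + ‖Complex.I * Real.pi * A * c‖, fun t ht => ?_⟩
  have h4 : x t = x 0 - (Complex.I * Real.pi * A * c) * t := by
    have := h3 t
    simp only [Complex.ofReal_zero, mul_zero, add_zero] at this
    linear_combination this
  rw [h4]
  refine (norm_sub_le _ _).trans ?_
  rw [norm_mul _ (t : ℂ), Complex.norm_real, Real.norm_eq_abs, abs_of_nonneg ht]
  have := mul_nonneg (norm_nonneg (x 0)) ht
  nlinarith [norm_nonneg (Complex.I * Real.pi * A * c)]

/-- The form (A+A')/2 · (|x|²+|y|²) + 2B Re(xy) is conserved, and the hypothesis makes it positive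
definite. -/
theorem norm_le_of_elliptic {A A' B : ℝ} (hB : |B| < (A + A') / 2) {x y : ℝ → ℂ}
    (hdx : ∀ t, HasDerivAt x (-Complex.I * Real.pi * (A * x t + B * (starRingEnd ℂ) (y t))) t)
    (hdy : ∀ t, HasDerivAt y (-Complex.I * Real.pi * (A' * y t + B * (starRingEnd ℂ) (x t))) t) :
    ∃ C, ∀ t, ‖x t‖ ≤ C := by
  have h : ∀ t, HasDerivAt (fun t : ℝ => ((A + A') / 2 : ℂ) * (x t * (starRingEnd ℂ) (x t) +
      y t * (starRingEnd ℂ) (y t)) + B * (x t * y t + (starRingEnd ℂ) (x t) * (starRingEnd ℂ) (y t))) 0 t := by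
    intro t
    have sx := (hdx t).star
    have sy := (hdy t).star
    refine (((((hdx t).mul sx).add ((hdy t).mul sy)).const_mul _).add
      ((((hdx t).mul (hdy t)).add (sx.mul sy)).const_mul _)).congr_deriv ?_
    simp only [← starRingEnd_apply, map_mul, map_neg, Complex.conj_I, map_add, Complex.conj_ofReal,
        Complex.conj_conj]
    ring
  set Q : ℝ := (A + A') / 2 * (‖x 0‖ ^ 2 + ‖y 0‖ ^ 2) + 2 * B * (x 0 * y 0).re with hQ
  have hq : ∀ t, (A + A') / 2 * (‖x t‖ ^ 2 + ‖y t‖ ^ 2) + 2 * B * (x t * y t).re = Q := by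
    intro t
    have h1 := congrArg Complex.re (eq_of_hasDerivAt_zero h t)
    simp only [hQ, ← Complex.normSq_eq_norm_sq, Complex.normSq_apply]
    simp at h1 ⊢
    linarith
  set δ := (A + A') / 2 - |B| with hδ
  have hδ0 : 0 < δ := by linarith
  refine ⟨Real.sqrt (Q / δ), fun t => Real.le_sqrt_of_sq_le ?_⟩
  rw [le_div_iff₀ hδ0]
  have h1 : |B * (2 * (x t * y t).re)| ≤ |B| * (‖x t‖ ^ 2 + ‖y t‖ ^ 2) := by
    rw [abs_mul]
    refine mul_le_mul_of_nonneg_left ?_ (abs_nonneg _)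
    rw [abs_mul, abs_two]
    have := Complex.abs_re_le_norm (x t * y t)
    rw [norm_mul] at this
    nlinarith [sq_nonneg (‖x t‖ - ‖y t‖)]
  have h2 := neg_abs_le (B * (2 * (x t * y t).re))
  have h3 := hq t
  have h4 := mul_nonneg hδ0.le (sq_nonneg ‖y t‖)
  simp only [hδ] at h4 ⊢
  nlinarith

/-! ### Sizes of the coupling coefficients -/

/-- The discriminant of the equations of the modes `n` and `2N - n`: the pair is unstable if and only
if it is positive. -/
noncomputable def disc (N n : ℕ) : ℝ := beta N n ^ 2 -
  (((2 * alpha N n - alpha N N) + (2 * alpha N (2 * N - n) - alpha N N)) / 2) ^ 2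

theorem alpha_pos (N n : ℕ) : 0 < alpha N n := by
  have : 0 < (n + N).choose N := Nat.choose_pos (by omega)
  unfold alpha; positivity

theorem alpha_succ (N n : ℕ) : alpha N (n + 1) * (2 * (n + 1)) = alpha N n * (n + 1 + N) := by
  have h : ((n + 1 + N).choose N : ℝ) * (n + 1) = (n + N).choose N * (n + 1 + N) := by
    have h1 := Nat.choose_mul_succ_eq (n + N) N
    have h2 : n + N + 1 - N = n + 1 := by omega
    rw [h2, show n + N + 1 = n + 1 + N by ring] at h1
    exact_mod_cast h1.symm
  unfold alpha
  rw [show n + 1 + N = n + N + 1 by ring, pow_succ] at *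
  field_simp
  linarith

theorem beta_nonneg (N n : ℕ) : 0 ≤ beta N n := by
  unfold beta
  have h1 := cst_pos n
  have h2 := cst_pos (2 * N - n)
  have := Real.pi_pos
  split_ifs <;> positivity

theorem beta_sq {N n m : ℕ} (h : n + m = 2 * N) :
    beta N n ^ 2 * (n.factorial * m.factorial) = (alpha N N * N.factorial) ^ 2 := by
  have hm : 2 * N - n = m := by omega
  rw [beta, if_pos (by omega), hm, alpha]
  have h1 := cst_mul_cst n
  have h2 := cst_mul_cst m
  have h3 : ((N + N).choose N : ℝ) * N.factorial * N.factorial = (2 * N).factorial := by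
    rw [two_mul, ← Nat.add_choose_mul_factorial_mul_factorial N N]; push_cast; ring
  have hN : (N.factorial : ℝ) ≠ 0 := by exact_mod_cast N.factorial_ne_zero
  rw [← h3, show (2 : ℝ) ^ (N + N) = 4 ^ N by rw [← two_mul, pow_mul]; norm_num]
  have e1 : ((N + N).choose N : ℝ) * N.factorial * N.factorial / (4 ^ N * N.factorial)
      = (N + N).choose N / 4 ^ N * N.factorial := by field_simp
  rw [e1]
  linear_combination ((N + N).choose N / 4 ^ N * N.factorial : ℝ) ^ 2 *
    ((cst m * cst m * (Real.pi * m.factorial)) * h1 + h2)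

theorem beta_pos {N n : ℕ} (h : n ≤ 2 * N) : 0 < beta N n := by
  unfold beta
  have h1 := cst_pos n
  have h2 := cst_pos (2 * N - n)
  have := Real.pi_pos
  have := Nat.factorial_pos (2 * N)
  have := Nat.factorial_pos N
  rw [if_pos h]
  positivity

theorem beta_symm {N n m : ℕ} (h : n + m = 2 * N) : beta N n = beta N m := by
  rw [beta, beta, if_pos (by omega), if_pos (by omega), show 2 * N - n = m by omega,
    show 2 * N - m = n by omega]
  ring

theorem beta_self (N : ℕ) : beta N N = alpha N N := by
  have h := beta_sq (N := N) (two_mul N).symm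
  have hN : (0 : ℝ) < N.factorial := by exact_mod_cast N.factorial_pos
  have h1 : beta N N ^ 2 = alpha N N ^ 2 := by
    apply mul_right_cancel₀ (b := (N.factorial * N.factorial : ℝ)) (by positivity)
    rw [h]; ring
  exact (pow_left_inj₀ (beta_nonneg N N) (alpha_pos N N).le two_ne_zero).1 h1

theorem disc_symm {N n m : ℕ} (h : n + m = 2 * N) : disc N n = disc N m := by
  rw [disc, disc, beta_symm h, show 2 * N - n = m by omega, show 2 * N - m = n by omega]
  ring

/-- The ratio of consecutive terms is 1 - (k+1)/(2(N+k+1)) ≤ e^{-(k+1)/(4N)}, as N+k+1 ≤ 2N; the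
exponents add up. -/
theorem alpha_add_le (N k : ℕ) (hk : k ≤ N) :
    alpha N (N + k) ≤ alpha N N * Real.exp (-(k * (k + 1) / (8 * N))) := by
  induction k with
  | zero => simp
  | succ k ih =>
    have hN : (0 : ℝ) < N := by exact_mod_cast (by omega : 0 < N)
    have hkN : ((k : ℝ) + 1) ≤ N := by exact_mod_cast hk
    have h1 := alpha_succ N (N + k)
    push_cast at h1
    have h2 : alpha N (N + (k + 1)) = alpha N (N + k) * (1 - (k + 1) / (2 * (N + k + 1))) := by
      rw [← add_assoc]
      field_simp
      linear_combination h1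
    have h3 : 1 - ((k : ℝ) + 1) / (2 * (N + k + 1)) ≤ Real.exp (-((k + 1) / (4 * N))) := by
      have h4 : ((k : ℝ) + 1) / (4 * N) ≤ (k + 1) / (2 * (N + k + 1)) := by
        apply div_le_div_of_nonneg_left (by positivity) (by positivity) (by linarith)
      have := Real.add_one_le_exp (-(((k : ℝ) + 1) / (4 * N)))
      linarith
    rw [h2]
    calc _ ≤ alpha N N * Real.exp (-(k * (k + 1) / (8 * N))) * Real.exp (-((k + 1) / (4 * N))) := by
          refine mul_le_mul (ih (by omega)) h3 ?_ (by have := alpha_pos N N; positivity)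
          rw [sub_nonneg, div_le_one (by positivity)]
          linarith
      _ = _ := by
        rw [mul_assoc, ← Real.exp_add]
        congr 2
        push_cast
        field_simp
        ring

/-- Downwards the ratio is 1 - k/(2N-k) ≤ e^{-k/(2N)}. The first step costs nothing since α_{N-1} =
α_N, whence k(k-1). -/
theorem alpha_sub_le (N m k : ℕ) (hk : m + k = N) :
    alpha N m ≤ alpha N N * Real.exp (-(k * (k - 1) / (4 * N))) := by
  induction k generalizing m with
  | zero => simp at hk; simp [hk]
  | succ k ih =>
    have ih := ih (m + 1) (by omega)
    have hN : (0 : ℝ) < N := by exact_mod_cast (by omega : 0 < N)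
    have hmk : (m : ℝ) + k + 1 = N := by exact_mod_cast hk
    have h1 := alpha_succ N m
    have h2 : alpha N m = alpha N (m + 1) * (1 - k / (2 * N - k)) := by
      have : (2 * N - k : ℝ) ≠ 0 := by
        have : (k : ℝ) < N := by have : (0 : ℝ) ≤ m := m.cast_nonneg
                                 linarith
        intro h; linarith
      have e : (m : ℝ) = N - k - 1 := by linarith
      rw [e] at h1
      field_simp
      linear_combination -h1
    have h3 : 1 - (k : ℝ) / (2 * N - k) ≤ Real.exp (-(k / (2 * N))) := by
      have h4 : (k : ℝ) / (2 * N) ≤ k / (2 * N - k) := by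
        gcongr
        · have : (0 : ℝ) ≤ m := m.cast_nonneg
          linarith
        · have : (0 : ℝ) ≤ k := k.cast_nonneg
          linarith
      have := Real.add_one_le_exp (-((k : ℝ) / (2 * N)))
      linarith
    rw [h2]
    calc _ ≤ alpha N N * Real.exp (-(k * (k - 1) / (4 * N))) * Real.exp (-(k / (2 * N))) := by
          refine mul_le_mul ih h3 ?_ (by have := alpha_pos N N; positivity)
          have : (0 : ℝ) ≤ m := m.cast_nonneg
          rw [sub_nonneg, div_le_one (by linarith)]
          linarith
      _ = _ := by
        rw [mul_assoc, ← Real.exp_add]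
        congr 2
        push_cast
        field_simp
        ring

/-- The squares are compared: with m = N-k-1, their ratio is (m+1)/(N+k+1) ≤ 1 - k/N ≤ e^{-k/N}. -/
theorem beta_le (N m k : ℕ) (hk : m + k = N) :
    beta N (N + k) ≤ alpha N N * Real.exp (-(k * (k - 1) / (4 * N))) := by
  have hα := alpha_pos N N
  apply le_of_sq_le_sq _ (by positivity)
  rw [mul_pow, ← Real.exp_nat_mul]
  induction k generalizing m with
  | zero => simp [beta_self]
  | succ k ih =>
    have ih := ih (m + 1) (by omega)
    have hN : (0 : ℝ) < N := by exact_mod_cast (by omega : 0 < N)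
    have hmk : (m : ℝ) + k + 1 = N := by exact_mod_cast hk
    have hk0 : (0 : ℝ) ≤ k := k.cast_nonneg
    have b1 := beta_sq (N := N) (n := N + k) (m := m + 1) (by omega)
    have b2 := beta_sq (N := N) (n := N + (k + 1)) (m := m) (by omega)
    have hm : (0 : ℝ) < m.factorial := by exact_mod_cast m.factorial_pos
    have hn : (0 : ℝ) < (N + k).factorial := by exact_mod_cast (N + k).factorial_pos
    rw [← b1, ← add_assoc, Nat.factorial_succ, Nat.factorial_succ m] at b2
    push_cast at b2
    have h2 : beta N (N + (k + 1)) ^ 2 * (N + k + 1) = beta N (N + k) ^ 2 * (m + 1) := by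
      apply mul_right_cancel₀ (b := ((N + k).factorial * m.factorial : ℝ)) (by positivity)
      rw [← add_assoc]
      linear_combination b2
    have h3 : ((m : ℝ) + 1) / (N + k + 1) ≤ Real.exp (-(k / N)) := by
      have h4 : ((m : ℝ) + 1) / (N + k + 1) ≤ 1 - k / N := by
        have e : 1 - (k : ℝ) / N = (m + 1) / N := by field_simp; linarith
        rw [e]
        gcongr
        linarith
      have := Real.add_one_le_exp (-((k : ℝ) / N))
      linarith
    have h5 : beta N (N + (k + 1)) ^ 2 = beta N (N + k) ^ 2 * ((m + 1) / (N + k + 1)) := by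
      field_simp; linarith
    rw [h5]
    calc _ ≤ alpha N N ^ 2 * Real.exp ((2 : ℕ) * -(k * (k - 1) / (4 * N))) * Real.exp (-(k / N)) := by
          refine mul_le_mul ih h3 (by positivity) (by positivity)
      _ = _ := by
        rw [mul_assoc, ← Real.exp_add]
        congr 2
        push_cast
        field_simp
        ring

theorem disc_nonpos_of_large {N m k : ℕ} (hk : m + k = N) (hN : 0 < N) (h : 16 * N ≤ k * (k - 1)) :
    disc N (N + k) ≤ 0 := by
  have hα := alpha_pos N N
  have hN' : (0 : ℝ) < N := by exact_mod_cast hN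
  have hk1 : 1 ≤ k := by
    by_contra h0
    have : k = 0 := by omega
    subst this; omega
  have hr : 16 * (N : ℝ) ≤ k * (k - 1) := by
    have := (Nat.cast_le (α := ℝ)).2 h
    push_cast [Nat.cast_sub hk1] at this
    exact this
  have hk0 : (0 : ℝ) ≤ k := k.cast_nonneg
  -- The threshold 16N makes both exponents at most -2. With α_{N+k}, α_{N-k} and β all at most
  -- α_N/3, the half-trace is at most -α_N/3, so its absolute value is at least β.
  have he : Real.exp (-2) ≤ 1 / 3 := by
    rw [Real.exp_neg, inv_eq_one_div]
    have := Real.add_one_le_exp 2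
    apply one_div_le_one_div_of_le (by norm_num) (by linarith)
  have e1 : Real.exp (-(k * (k + 1) / (8 * N))) ≤ 1 / 3 := by
    refine le_trans (Real.exp_le_exp.2 ?_) he
    rw [neg_le_neg_iff, le_div_iff₀ (by positivity)]
    nlinarith
  have e2 : Real.exp (-(k * (k - 1) / (4 * N))) ≤ 1 / 3 := by
    refine le_trans (Real.exp_le_exp.2 ?_) he
    rw [neg_le_neg_iff, le_div_iff₀ (by positivity)]
    nlinarith
  have a1 := (alpha_add_le N k (by omega)).trans (mul_le_mul_of_nonneg_left e1 hα.le)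
  have a2 := (alpha_sub_le N m k hk).trans (mul_le_mul_of_nonneg_left e2 hα.le)
  have a3 := (beta_le N m k hk).trans (mul_le_mul_of_nonneg_left e2 hα.le)
  have b0 := beta_nonneg N (N + k)
  rw [disc, show 2 * N - (N + k) = m by omega, sub_nonpos]
  have : beta N (N + k) ≤ -(((2 * alpha N (N + k) - alpha N N) + (2 * alpha N m - alpha N N)) / 2) := by
    linarith
  calc _ ≤ (-(((2 * alpha N (N + k) - alpha N N) + (2 * alpha N m - alpha N N)) / 2)) ^ 2 := by gcongr
    _ = _ := by ring

theorem disc_self (N : ℕ) : disc N N = 0 := by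
  rw [disc, show 2 * N - N = N by omega, beta_self]; ring

/-- With N = M+2, the pair (N+2, N-2): every α and β² is a rational function of M times a power of
α_N, and the claim becomes a polynomial inequality in M. -/
theorem disc_pos (M : ℕ) : 0 < disc (M + 2) (M + 4) := by
  have hα := alpha_pos (M + 2) M
  have p1 := alpha_succ (M + 2) M
  have p2 := alpha_succ (M + 2) (M + 1)
  have p3 := alpha_succ (M + 2) (M + 2)
  have p4 := alpha_succ (M + 2) (M + 3)
  have hb := beta_sq (N := M + 2) (n := M + 4) (m := M) (by omega)
  have hf : (0 : ℝ) < M.factorial := by exact_mod_cast M.factorial_pos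
  rw [disc, show 2 * (M + 2) - (M + 4) = M by omega, sub_pos]
  set a := alpha (M + 2) M
  simp only [Nat.factorial_succ] at hb
  push_cast at p1 p2 p3 p4 hb
  set x : ℝ := (M : ℝ) with hx
  have hx0 : 0 ≤ x := M.cast_nonneg
  have q1 : alpha (M + 2) (M + 1) = a * ((2 * x + 3) / (2 * (x + 1))) := by
    field_simp; linear_combination p1
  have q2 : alpha (M + 2) (M + 2) = a * ((2 * x + 3) / (2 * (x + 1))) := by
    have : alpha (M + 2) (M + 2) = alpha (M + 2) (M + 1) := by
      apply mul_right_cancel₀ (b := 2 * (x + 1 + 1)) (by positivity)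
      linear_combination p2
    rw [this, q1]
  have q3 : alpha (M + 2) (M + 3) = a * ((2 * x + 3) * (2 * x + 5) / (4 * (x + 1) * (x + 3))) := by
    rw [q2] at p3
    field_simp at p3 ⊢
    linear_combination p3
  have q4 : alpha (M + 2) (M + 4)
      = a * ((2 * x + 3) * (2 * x + 5) * (2 * x + 6) / (8 * (x + 1) * (x + 3) * (x + 4))) := by
    rw [q3] at p4
    field_simp at p4 ⊢
    linear_combination p4
  have hA := alpha_pos (M + 2) (M + 2)
  set A := alpha (M + 2) (M + 2)
  have hS : ((2 * alpha (M + 2) (M + 4) - A) + (2 * a - A)) / 2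
      = A * ((4 * x ^ 2 + 14 * x + 7) / (2 * (x + 4) * (2 * x + 3))) := by
    rw [q4, q2]; field_simp; ring
  have hB : beta (M + 2) (M + 4) ^ 2 = A ^ 2 * ((x + 2) * (x + 1) / ((x + 4) * (x + 3))) := by
    field_simp
    apply mul_right_cancel₀ (b := ((x + 2) * (x + 1) * M.factorial * M.factorial)) (by positivity)
    linear_combination hb
  rw [hS, hB, mul_pow]
  refine mul_lt_mul_of_pos_left ?_ (by positivity)
  rw [div_pow, div_lt_div_iff₀ (by positivity) (by positivity)]
  -- After clearing denominators the difference of the two sides is (x+4) times this cubic, whose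
  -- coefficients are all positive.
  have h1 : 0 < 8 * x ^ 3 + 100 * x ^ 2 + 251 * x + 141 := by positivity
  have h2 := mul_pos (by positivity : 0 < x + 4) h1
  linarith

/-! ### Growing modes -/

/-- The eigenvalue of the mode `n`. -/
noncomputable def growthRate (N n : ℕ) : ℂ :=
  Real.sqrt (Real.pi ^ 2 * disc N n) - Complex.I *
    (Real.pi * ((2 * alpha N n - alpha N N) - (2 * alpha N (2 * N - n) - alpha N N)) / 2 : ℝ)

noncomputable def unstableModes (N : ℕ) : Finset ℕ :=
  (Finset.range (2 * N + 1)).filter fun n => 0 < disc N n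

theorem hasDerivAt_rotCoef_pair {N : ℕ} {v : ℝ → ℂ → ℂ} (hv : IsLinearizedSolution N v) {n m : ℕ}
    (h : n + m = 2 * N) (t : ℝ) :
    HasDerivAt (rotCoef N v n) (-Complex.I * Real.pi * (((2 * alpha N n - alpha N N : ℝ) : ℂ) *
      rotCoef N v n t + beta N n * (starRingEnd ℂ) (rotCoef N v m t))) t := by
  have := hasDerivAt_rotCoef hv n t
  rw [show 2 * N - n = m by omega] at this
  exact this.congr_deriv (by push_cast; ring)

theorem hasDerivAt_rotCoef_large {N : ℕ} {v : ℝ → ℂ → ℂ} (hv : IsLinearizedSolution N v) {n : ℕ}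
    (h : 2 * N < n) (t : ℝ) :
    HasDerivAt (rotCoef N v n) (-Complex.I * Real.pi * (((2 * alpha N n - alpha N N : ℝ) : ℂ) *
      rotCoef N v n t)) t := by
  have := hasDerivAt_rotCoef hv n t
  rw [beta, if_neg (by omega)] at this
  exact this.congr_deriv (by push_cast; ring)

theorem IsGrowingMode.rotCoef_eq {N : ℕ} {v : ℝ → ℂ → ℂ} (hv : IsGrowingMode N v) (n : ℕ) :
    ∃ p : ℂ, (n ∉ unstableModes N → p = 0) ∧
      ∀ t : ℝ, rotCoef N v n t = Complex.exp (growthRate N n * t) * p := by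
  obtain ⟨hl, -, μ, hμ, a, ha, b, hb, hvab⟩ := hv
  have hx : ∀ t, rotCoef N v n t = Complex.exp (μ * t) * coef n a +
      Complex.exp ((starRingEnd ℂ) μ * t) * coef n b := by
    intro t
    have e : v t = fun z => phase N t * (Complex.exp (μ * t) * a z +
      Complex.exp ((starRingEnd ℂ) μ * t) * b z) := funext (hvab t)
    have hp := phase_ne_zero N t
    rw [rotCoef, e, coef_const_mul, coef_add (ha.1.const_mul _) (hb.1.const_mul _), coef_const_mul,
      coef_const_mul, inv_mul_cancel_left₀ hp]
  by_cases hn : n ≤ 2 * N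
  · have h1 : n + (2 * N - n) = 2 * N := by omega
    obtain ⟨p, hp, hpx⟩ := growing_pair hμ hx (fun t => hasDerivAt_rotCoef_pair hl h1 t)
      (fun t => by
        have := hasDerivAt_rotCoef_pair hl (n := 2 * N - n) (m := n) (by omega) t
        rwa [← beta_symm h1] at this)
    refine ⟨p, fun h => hp ?_, hpx⟩
    by_contra h0
    exact h (Finset.mem_filter.2 ⟨Finset.mem_range.2 (by omega), not_le.1 h0⟩)
  -- A decoupled mode is treated as a pair with B = 0 and zero partner; its discriminant is -A² ≤ 0,
  -- so it vanishes.
  · obtain ⟨p, hp, hpx⟩ := growing_pair (B := 0) (A := 2 * alpha N n - alpha N N)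
      (A' := 2 * alpha N n - alpha N N) (y := fun _ => 0) hμ hx
      (fun t => (hasDerivAt_rotCoef_large hl (not_le.1 hn) t).congr_deriv (by simp))
      (fun t => (hasDerivAt_const t (0 : ℂ)).congr_deriv (by simp))
    have hp0 := hp (by nlinarith [sq_nonneg ((2 * alpha N n - alpha N N +
      (2 * alpha N n - alpha N N)) / 2)])
    exact ⟨0, fun _ => rfl, fun t => by rw [hpx, hp0, mul_zero, mul_zero]⟩

theorem IsGrowingMode.eq_sum {N : ℕ} {v : ℝ → ℂ → ℂ} (hv : IsGrowingMode N v) :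
    ∃ p : ℕ → ℂ, ∀ t z, v t z = ∑ n ∈ unstableModes N,
      phase N t * (Complex.exp (growthRate N n * t) * p n) * phi n z := by
  choose p hp hpx using hv.rotCoef_eq
  refine ⟨p, fun t z => ?_⟩
  obtain ⟨f, hf, hfv, hL⟩ := mem_bargmannFock_iff.1 (hv.1.1 t)
  have hc : ∀ n, coef n (v t) = phase N t * (Complex.exp (growthRate N n * t) * p n) := by
    intro n
    rw [← hpx, rotCoef, mul_inv_cancel_left₀ (phase_ne_zero N t)]
  have hfs : f = fun z => ∑ n ∈ unstableModes N, (cst n * coef n (v t)) * z ^ n := by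
    apply eq_of_tay_eq hf (by fun_prop)
    intro n
    rw [tay_sum_pow, ← coef_gw hf hL, ← hfv]
    split_ifs with h
    · rfl
    · rw [hc, hp n h]; simp
  rw [hfv, gw, hfs, Finset.sum_mul]
  refine Finset.sum_congr rfl fun n _ => ?_
  rw [hc, phi_eq, gw]
  ring

/-- The space of curves supported on the unstable modes. -/
noncomputable def modeMap (N : ℕ) : (unstableModes N → ℂ) →ₗ[ℝ] (ℝ → ℂ → ℂ) where
  toFun p t z := ∑ n : unstableModes N,
    phase N t * (Complex.exp (growthRate N n * t) * p n) * phi n z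
  map_add' p q := by
    ext t z
    simp only [Pi.add_apply, ← Finset.sum_add_distrib]
    exact Finset.sum_congr rfl fun n _ => by ring
  map_smul' c p := by
    ext t z
    simp only [Pi.smul_apply, Complex.real_smul, RingHom.id_apply, Finset.mul_sum]
    exact Finset.sum_congr rfl fun n _ => by ring

theorem unstableSpace_le (N : ℕ) : unstableSpace N ≤ LinearMap.range (modeMap N) := by
  refine Submodule.span_le.2 fun v hv => ?_
  obtain ⟨p, hp⟩ := IsGrowingMode.eq_sum hv
  refine ⟨fun n => p n, ?_⟩
  ext t z
  rw [hp]
  exact Finset.sum_coe_sort (unstableModes N)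
    fun n => phase N t * (Complex.exp (growthRate N n * t) * p n) * phi n z

instance finite_unstableSpace (N : ℕ) : Module.Finite ℝ (unstableSpace N) :=
  Submodule.finiteDimensional_of_le (unstableSpace_le N)

/-- One complex parameter per unstable index. The constraint linking n with 2N-n is ignored, which
at most loses a constant factor. -/
theorem finrank_unstableSpace_le (N : ℕ) :
    Module.finrank ℝ (unstableSpace N) ≤ 2 * (unstableModes N).card := by
  refine (Submodule.finrank_mono (unstableSpace_le N)).trans ((LinearMap.finrank_range_le _).trans ?_)
  rw [Module.finrank_pi_fintype]
  simp [mul_comm]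

theorem card_unstableModes_le {N : ℕ} (hN : 0 < N) :
    (unstableModes N).card ≤ 2 * (Nat.sqrt (16 * N) + 1) + 1 := by
  set r := Nat.sqrt (16 * N) + 1 with hr
  have hs : 16 * N < r * r := by
    have := Nat.lt_succ_sqrt (16 * N)
    simpa [hr] using this
  have hlarge : ∀ m k, m + k = N → r < k → disc N (N + k) ≤ 0 := by
    intro m k hmk hk
    refine disc_nonpos_of_large hmk hN (hs.le.trans ?_)
    exact Nat.mul_le_mul hk.le (by omega)
  have hsub : unstableModes N ⊆ Finset.Icc (N - r) (N + r) := by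
    intro n hn
    obtain ⟨h1, h2⟩ := Finset.mem_filter.1 hn
    have h1 := Finset.mem_range.1 h1
    rw [Finset.mem_Icc]
    by_contra h3
    rcases Nat.lt_or_ge N n with h4 | h4
    · have := hlarge (2 * N - n) (n - N) (by omega) (by omega)
      rw [show N + (n - N) = n by omega] at this
      linarith
    · have := hlarge n (N - n) (by omega) (by omega)
      rw [disc_symm (n := n) (m := N + (N - n)) (by omega)] at h2
      linarith
  refine (Finset.card_le_card hsub).trans ?_
  rw [Nat.card_Icc]
  omega

theorem isLittleO_finrank : (fun N : ℕ => (Module.finrank ℝ (unstableSpace N) : ℝ)) =o[atTop]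
    (fun N : ℕ => (N : ℝ)) := by
  have h1 : (fun N : ℕ => (Module.finrank ℝ (unstableSpace N) : ℝ)) =O[atTop]
      (fun N : ℕ => Real.sqrt N) := by
    refine IsBigO.of_bound 22 ((eventually_gt_atTop 0).mono fun N hN => ?_)
    have h2 := (finrank_unstableSpace_le N).trans (Nat.mul_le_mul_left 2 (card_unstableModes_le hN))
    have h3 : (Nat.sqrt (16 * N) : ℝ) ≤ 4 * Real.sqrt N := by
      have := Real.nat_sqrt_le_real_sqrt (a := 16 * N)
      push_cast at this
      rwa [Real.sqrt_mul (by norm_num), show (16 : ℝ) = 4 ^ 2 by norm_num,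
        Real.sqrt_sq (by norm_num)] at this
    have h4 : 1 ≤ Real.sqrt N := by
      rw [Real.one_le_sqrt]; exact_mod_cast hN
    rw [Real.norm_of_nonneg (Nat.cast_nonneg _), Real.norm_of_nonneg (Real.sqrt_nonneg _)]
    have h5 : (Module.finrank ℝ (unstableSpace N) : ℝ) ≤ 2 * (2 * (Nat.sqrt (16 * N) + 1) + 1) := by
      exact_mod_cast h2
    linarith
  refine h1.trans_isLittleO ?_
  have h2 : (fun x : ℝ => Real.sqrt x) =o[atTop] fun x : ℝ => x := by
    refine isLittleO_iff.2 fun c hc => (eventually_ge_atTop ((1 / c) ^ 2)).mono fun x hx => ?_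
    have hx0 : 0 ≤ x := le_trans (by positivity) hx
    have h3 : 1 / c ≤ Real.sqrt x := Real.le_sqrt_of_sq_le hx
    rw [div_le_iff₀' hc] at h3
    rw [Real.norm_of_nonneg (Real.sqrt_nonneg _), Real.norm_of_nonneg hx0]
    nlinarith [Real.sq_sqrt hx0, Real.sqrt_nonneg x]
  exact h2.comp_tendsto tendsto_natCast_atTop_atTop

theorem linearlyStable_of_disc_nonpos {N : ℕ} (h : ∀ n, n ≤ 2 * N → disc N n ≤ 0) :
    LinearlyStable N := by
  intro v hv
  obtain ⟨p, hp⟩ := hv.eq_sum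
  have he : unstableModes N = ∅ := by
    refine Finset.filter_eq_empty_iff.2 fun n hn => ?_
    have := Finset.mem_range.1 hn
    exact not_lt.2 (h n (by omega))
  apply hv.2.1
  ext t z
  rw [hp, he]
  simp

/-! ### Growth of general solutions -/

theorem norm_rotCoef (N : ℕ) (v : ℝ → ℂ → ℂ) (n : ℕ) (t : ℝ) : ‖rotCoef N v n t‖ = ‖coef n (v t)‖ := by
  rw [rotCoef, norm_mul, norm_inv, norm_phase, inv_one, one_mul]

/-- Coefficients beyond 2N keep their modulus and are controlled by the initial norm through Bessel;
the finitely many others grow linearly. Thus the norm is O(1+t). -/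
theorem isBigO_exp_of_coef_le {N : ℕ} {v : ℝ → ℂ → ℂ} (hv : IsLinearizedSolution N v)
    (h : ∀ n, n ≤ 2 * N → ∃ C, ∀ t, 0 ≤ t → ‖rotCoef N v n t‖ ≤ C * (1 + t)) {σ : ℝ} (hσ : 0 < σ) :
    (fun t : ℝ => (eLpNorm (v t) 2 volume).toReal) =O[atTop] (fun t : ℝ => Real.exp (σ * t)) := by
  choose! C hC using h
  set K := ∑ n ∈ Finset.range (2 * N + 1), C n ^ 2 with hK
  set M := (eLpNorm (v 0) 2 volume).toReal ^ 2 with hM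
  have hK0 : 0 ≤ K := Finset.sum_nonneg fun n _ => sq_nonneg _
  have hM0 : 0 ≤ M := sq_nonneg _
  have hb : ∀ t, 0 ≤ t → (eLpNorm (v t) 2 volume).toReal ≤ Real.sqrt (M + K) * (1 + t) := by
    intro t ht
    have h1 : (eLpNorm (v t) 2 volume).toReal ≤ Real.sqrt (M + K * (1 + t) ^ 2) := by
      refine eLpNorm_le_of_sum_sq_coef_le (hv.1 t) fun k => ?_
      have h2 : ∀ n ∈ Finset.range k, ‖coef n (v t)‖ ^ 2 ≤ ‖coef n (v 0)‖ ^ 2 +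
          if n ∈ Finset.range (2 * N + 1) then C n ^ 2 * (1 + t) ^ 2 else 0 := by
        intro n _
        simp only [← norm_rotCoef N]
        split_ifs with hn
        · have := hC n (by have := Finset.mem_range.1 hn; omega) t ht
          rw [← mul_pow]
          have h3 : ‖rotCoef N v n t‖ ^ 2 ≤ (C n * (1 + t)) ^ 2 := by gcongr
          linarith [sq_nonneg ‖rotCoef N v n 0‖]
        · have hn' : 2 * N < n := by
            by_contra h0
            exact hn (Finset.mem_range.2 (by omega))
          rw [norm_eq_of_decoupled (hasDerivAt_rotCoef_large hv hn') t, add_zero]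
      refine (Finset.sum_le_sum h2).trans ?_
      rw [Finset.sum_add_distrib]
      refine add_le_add (sum_sq_coef_le (hv.1 0).1 _) ?_
      rw [hK, Finset.sum_mul, ← Finset.sum_filter]
      refine Finset.sum_le_sum_of_subset_of_nonneg ?_ fun n _ _ => by positivity
      intro n hn
      exact (Finset.mem_filter.1 hn).2
    refine h1.trans (Real.sqrt_le_iff.2 ⟨by positivity, ?_⟩)
    rw [mul_pow, Real.sq_sqrt (by positivity)]
    have : (1 : ℝ) ≤ (1 + t) ^ 2 := by nlinarith
    nlinarith
  refine IsBigO.of_bound (Real.sqrt (M + K) * (1 + 1 / σ)) ((eventually_ge_atTop 0).mono fun t ht => ?_)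
  rw [Real.norm_of_nonneg ENNReal.toReal_nonneg, Real.norm_of_nonneg (Real.exp_pos _).le, mul_assoc]
  refine (hb t ht).trans (mul_le_mul_of_nonneg_left ?_ (Real.sqrt_nonneg _))
  have h1 : 1 ≤ Real.exp (σ * t) := Real.one_le_exp (by positivity)
  have h2 : t ≤ 1 / σ * Real.exp (σ * t) := by
    rw [div_mul_eq_mul_div, one_mul, le_div_iff₀ hσ]
    have := Real.add_one_le_exp (σ * t)
    linarith
  linarith

theorem stable_of_elliptic {N : ℕ} (h : ∀ n, n ≤ 2 * N → n = N ∨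
    beta N n < ((2 * alpha N n - alpha N N) + (2 * alpha N (2 * N - n) - alpha N N)) / 2) :
    LinearlyStable N ∧ ∀ v : ℝ → ℂ → ℂ, IsLinearizedSolution N v → ∀ σ : ℝ, 0 < σ →
      (fun t : ℝ => (eLpNorm (v t) 2 volume).toReal) =O[atTop] (fun t : ℝ => Real.exp (σ * t)) := by
  refine ⟨linearlyStable_of_disc_nonpos fun n hn => ?_, fun v hv σ hσ =>
    isBigO_exp_of_coef_le hv (fun n hn => ?_) hσ⟩
  · rcases h n hn with rfl | h
    · exact (disc_self n).le
    · rw [disc, sub_nonpos]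
      have := beta_nonneg N n
      gcongr
  · have h1 : n + (2 * N - n) = 2 * N := by omega
    rcases h n hn with rfl | h
    · refine norm_le_of_degenerate (A := alpha n n) fun t =>
        (hasDerivAt_rotCoef_pair hv (two_mul n).symm t).congr_deriv ?_
      rw [beta_self]
      push_cast
      ring
    · obtain ⟨C, hC⟩ := norm_le_of_elliptic (by rwa [abs_of_nonneg (beta_nonneg N n)])
        (fun t => hasDerivAt_rotCoef_pair hv h1 t) (fun t => by
          have := hasDerivAt_rotCoef_pair hv (n := 2 * N - n) (m := n) (by omega) t
          rwa [← beta_symm h1] at this)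
      refine ⟨C, fun t ht => (hC t).trans ?_⟩
      have : 0 ≤ C := (norm_nonneg _).trans (hC 0)
      nlinarith

theorem beta_one_lt {n m : ℕ} (h : n + m = 2) (hn : n ≠ 1) :
    beta 1 n < ((2 * alpha 1 n - alpha 1 1) + (2 * alpha 1 m - alpha 1 1)) / 2 := by
  have hb := beta_sq (N := 1) (n := n) (m := m) (by omega)
  have h0 := beta_nonneg 1 n
  have : n = 0 ∨ n = 2 := by omega
  rcases this with rfl | rfl
  · have hm : m = 2 := by omega
    subst hm
    norm_num [alpha, Nat.factorial] at hb ⊢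
    nlinarith
  · have hm : m = 0 := by omega
    subst hm
    norm_num [alpha, Nat.factorial] at hb ⊢
    nlinarith

theorem stable_zero_one {N : ℕ} (hN : N = 0 ∨ N = 1) :
    LinearlyStable N ∧ ∀ v : ℝ → ℂ → ℂ, IsLinearizedSolution N v → ∀ σ : ℝ, 0 < σ →
      (fun t : ℝ => (eLpNorm (v t) 2 volume).toReal) =O[atTop] (fun t : ℝ => Real.exp (σ * t)) := by
  refine stable_of_elliptic fun n hn => ?_
  rcases hN with rfl | rfl
  · left; omega
  · by_cases h : n = 1
    · exact Or.inl h
    · exact Or.inr (beta_one_lt (by omega) h)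

/-! ### Instability -/

/-- The mode is e^{μt} on φ_n and q e^{conj(μ)t} on φ_m in the rotating frame; conjugation in the
coupling exchanges the two exponents, so the system reduces to these two algebraic equations. -/
theorem linearlyUnstable_of_eigenvector {N n m : ℕ} (hnm : n + m = 2 * N) (hne : n ≠ m) {μ q : ℂ}
    (hμ : 0 < μ.re)
    (en : μ = -Complex.I * Real.pi * ((2 * alpha N n - alpha N N) + beta N n * (starRingEnd ℂ) q))
    (em : (starRingEnd ℂ) μ * q = -Complex.I * Real.pi * ((2 * alpha N m - alpha N N) * q + beta N n)) :
    LinearlyUnstable N := by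
  set y : ℕ → ℝ → ℂ := fun k t => phase N t * (if k = n then Complex.exp (μ * t) else
    if k = m then Complex.exp ((starRingEnd ℂ) μ * t) * q else 0) with hy
  have hyn : ∀ t, y n t = phase N t * Complex.exp (μ * t) := fun t => by simp [hy]
  have hym : ∀ t, y m t = phase N t * (Complex.exp ((starRingEnd ℂ) μ * t) * q) := fun t => by
    simp [hy, hne.symm]
  have hyk : ∀ k, k ≠ n → k ≠ m → ∀ t, y k t = 0 := fun k h1 h2 t => by simp [hy, h1, h2]
  have hconj : ∀ (X : ℂ) (t : ℝ), (starRingEnd ℂ) (Complex.exp (X * t))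
      = Complex.exp ((starRingEnd ℂ) X * t) := by
    intro X t
    rw [← Complex.exp_conj, map_mul, Complex.conj_ofReal]
  have hsol := isLinearizedSolution_sum_phi N {n, m} y
    (fun k hk t => hyk k (fun h => hk (by simp [h])) (fun h => hk (by simp [h])) t) (by
      intro k t
      have hp := mul_inv_cancel₀ (phase_ne_zero N t)
      by_cases hkn : k = n
      · subst hkn
        have h1 := (hasDerivAt_phase N t).mul (hasDerivAt_cexp_mul μ t)
        have e : y k = phase N * fun t : ℝ => Complex.exp (μ * t) := funext hyn
        rw [← e] at h1
        refine h1.congr_deriv ?_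
        rw [show 2 * N - k = m by omega, hyn, hym, map_mul, map_mul, conj_phase, hconj,
          Complex.conj_conj, omega_eq]
        push_cast
        linear_combination (phase N t * Complex.exp (μ * t)) * en + (Complex.I * Real.pi * beta N k *
          phase N t * Complex.exp (μ * t) * (starRingEnd ℂ) q) * hp
      · by_cases hkm : k = m
        · subst hkm
          have h1 := (hasDerivAt_phase N t).mul ((hasDerivAt_cexp_mul ((starRingEnd ℂ) μ) t).mul_const q)
          have e : y k = phase N * fun t : ℝ => Complex.exp ((starRingEnd ℂ) μ * t) * q := funext hym
          rw [← e] at h1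
          refine h1.congr_deriv ?_
          rw [show 2 * N - k = n by omega, hyn, hym, map_mul, conj_phase, hconj, omega_eq,
            ← beta_symm hnm]
          push_cast
          linear_combination (phase N t * Complex.exp ((starRingEnd ℂ) μ * t)) * em +
            (Complex.I * Real.pi * beta N n * phase N t * Complex.exp ((starRingEnd ℂ) μ * t)) * hp
        · have e : y k = fun _ => 0 := funext (hyk k hkn hkm)
          rw [e]
          refine (hasDerivAt_const t (0 : ℂ)).congr_deriv ?_
          by_cases hk : k ≤ 2 * N
          · rw [hyk (2 * N - k) (by omega) (by omega)]; simp
          · rw [beta, if_neg hk]; simp)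
  have hbf : ∀ (c : ℂ) (k : ℕ), (fun z => c * phi k z) ∈ BargmannFock := by
    intro c k
    have e : (fun z => c * phi k z) = gw (fun z => c * (cst k * z ^ k)) := by
      ext z; simp only [phi_eq, gw, mul_assoc]
    exact mem_bargmannFock_iff.2 ⟨_, by fun_prop, e, e ▸ (memLp_phi k).const_mul c⟩
  have hsum : ∀ t z, ∑ k ∈ {n, m}, y k t * phi k z = phase N t * (Complex.exp (μ * t) * (1 * phi n z) +
      Complex.exp ((starRingEnd ℂ) μ * t) * (q * phi m z)) := by
    intro t z
    rw [Finset.sum_pair hne, hyn, hym]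
    ring
  refine ⟨_, hsol, ?_, μ, hμ, _, hbf 1 n, _, hbf q m, hsum⟩
  intro h0
  have h1 : coef n (fun z => ∑ k ∈ {n, m}, y k 0 * phi k z) = 0 := by
    rw [congrFun h0 0]
    simp [coef]
  simp only [hsum] at h1
  rw [coef_const_mul, coef_add (((memLp_phi n).const_mul 1).const_mul _)
    (((memLp_phi m).const_mul q).const_mul _)] at h1
  simp only [coef_const_mul] at h1
  rw [coef_phi, coef_phi, if_pos rfl, if_neg hne] at h1
  simp [phase_ne_zero] at h1

theorem linearlyUnstable_of_disc_pos {N n m : ℕ} (hnm : n + m = 2 * N) (hne : n ≠ m)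
    (hd : 0 < disc N n) : LinearlyUnstable N := by
  have hB : (beta N n : ℂ) ≠ 0 := by exact_mod_cast (beta_pos (by omega)).ne'
  set s := Real.sqrt (disc N n) with hs
  have hs0 : 0 < s := Real.sqrt_pos.2 hd
  set S : ℝ := alpha N n + alpha N m - alpha N N with hS
  have hs2 : s ^ 2 = beta N n ^ 2 - S ^ 2 := by
    rw [hs, Real.sq_sqrt hd.le, disc, show 2 * N - n = m by omega, hS]
    ring
  have hs2c : (s : ℂ) ^ 2 = beta N n ^ 2 - S ^ 2 := by exact_mod_cast hs2
  have hSc : (S : ℂ) = alpha N n + alpha N m - alpha N N := by rw [hS]; push_cast; ring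
  have hqB : (-Complex.I * s - S) / beta N n * beta N n = -Complex.I * s - S := div_mul_cancel₀ _ hB
  refine linearlyUnstable_of_eigenvector hnm hne
    -- This is the root found in `growing_pair`; q is then solved from the first equation, and the
    -- second holds because s² = β² - S².
    (μ := Real.pi * (s - Complex.I * ((alpha N n - alpha N m : ℝ) : ℂ)))
    (q := (-Complex.I * s - S) / beta N n) ?_ ?_ ?_
  · have := Real.pi_pos
    simp
    positivity
  · simp only [map_div₀, map_sub, map_mul, map_neg, Complex.conj_I, Complex.conj_ofReal, neg_neg]
    rw [mul_div_cancel₀ _ hB]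
    push_cast
    linear_combination (Real.pi * s) * Complex.I_sq - Complex.I * Real.pi * hSc
  · simp only [map_sub, map_mul, Complex.conj_I, Complex.conj_ofReal]
    apply mul_right_cancel₀ hB
    push_cast
    linear_combination (Real.pi * (s + Complex.I * (alpha N n - alpha N m)) + Complex.I * Real.pi *
      (2 * alpha N m - alpha N N)) * hqB - Complex.I * Real.pi * hs2c - (Real.pi * s * S) * Complex.I_sq +
      (Real.pi * s * Complex.I ^ 2 + Real.pi * Complex.I * S) * hSc

theorem linearlyUnstable_of_two_le {N : ℕ} (hN : 2 ≤ N) : LinearlyUnstable N := by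
  obtain ⟨M, rfl⟩ := Nat.exists_eq_add_of_le' hN
  exact linearlyUnstable_of_disc_pos (n := M + 4) (m := M) (by omega) (by omega) (disc_pos M)

end CR

theorem mainTheorem8 :
    -- the waves are solutions of the equation
    (∀ N : ℕ, CR.IsSolution (CR.wave N)) ∧
    -- stability for `N = 0, 1`; moreover no solution of the linearized equation grows exponentially
    (∀ N : ℕ, N = 0 ∨ N = 1 →
      CR.LinearlyStable N ∧
        ∀ v : ℝ → ℂ → ℂ, CR.IsLinearizedSolution N v → ∀ σ : ℝ, 0 < σ →
          (fun t : ℝ => (eLpNorm (v t) 2 volume).toReal) =O[atTop]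
            (fun t : ℝ => Real.exp (σ * t))) ∧
    -- instability for `N ≥ 2`
    (∀ N : ℕ, 2 ≤ N → CR.LinearlyUnstable N) ∧
    -- the number of unstable modes is finite, and `o(N)`
    (∀ N : ℕ, Module.Finite ℝ (CR.unstableSpace N)) ∧
    (fun N : ℕ => (Module.finrank ℝ (CR.unstableSpace N) : ℝ)) =o[atTop]
      (fun N : ℕ => (N : ℝ)) :=
  ⟨CR.isSolution_wave, fun _ hN => CR.stable_zero_one hN, fun _ hN => CR.linearlyUnstable_of_two_le hN,
    CR.finite_unstableSpace, CR.isLittleO_finrank⟩
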